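/- Let $T>0$, let $A\in L^\infty(\mathbb R,\mathbb R^{d\times d})$ and $B\in L^\infty(\mathbb R,\mathbb R^{d\times m})$ be $T$-periodic, and let $U\subset\mathbb R^m$ be a bounded convex neighborhood of $0$. Consider $$\dot x(t)=A(t)x(t)+B(t)u(t),\qquad u\in\mathcal U=\{u\in L^\infty(\mathbb R,\mathbb R^m): u(t)\in U\text{ for a.a. }t\},$$ with Carathéodory solutions $\varphi(t;t_0,x_0,u)$, $\varphi(t_0;t_0,x_0,u)=x_0$. Let $X(t,s)$ be the principal fundamental solution of $\dot x=A(t)x$, i.e. $\frac{d}{dt}X(t,s)=A(t)X(t,s)$, $X(s,s)=I$. For $t\ge t_0$ put $\mathbf R_t(t_0,x)=\{\varphi(t;t_0,x,u): u\in\mathcal U\}$, and for $t\le t_0$ put $\mathbf C_t(t_0,x)=\{y: \varphi(t_0;t,y,u)=x\text{ for some }u\in\mathcal U\}$. For $\tau\in[0,T)$ let $$\mathbf R_{\mathbb NT+\tau}(0,0)=\bigcup_{k\ge 0}\mathbf R_{kT+\tau}(0,0),\qquad \mathbf C_{-\mathbb NT+\tau}(0,0)=\bigcup_{k\ge 0,\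 -kT+\tau\le 0}\mathbf C_{-kT+\tau}(0,0).$$ For $\tau\in[0,T)$ and $\lambda\in\mathbb R$ let $L(\lambda,\tau)\subset\mathbb R^d$ be the sum of the real generalized eigenspaces (real parts of the complex generalized eigenspaces) of $X(T+\tau,\tau)$ for its eigenvalues $\mu$ with $\frac1T\log|\mu|=\lambda$, and let $E^-_\tau$, $E^+_\tau$, $E^{-,0}_\tau$, $E^{+,0}_\tau$ be the sums of the $L(\lambda,\tau)$ over $\lambda<0$, $\lambda>0$, $\lambda\le0$, $\lambda\ge0$, respectively. Let $\mathbb S^1=\mathbb R/T\mathbb Z$, parametrized by $[0,T)$. The autonomized system on $\mathbb S^1\times\mathbb R^d$ has the solutions $\varphi^a(t;(\tau_0,x_0),u)=(\tau_0+t \bmod T,\ \varphi(\tau_0+t;\tau_0,x_0,u))$, $\tau_0\in[0,T)$; let $\mathbf R^a(0,0)$ be the set of all points $\varphi^a(t;(0,0),u)$ with $t\ge0$, $u\in\mathcal U$, and $\mathbf C^a(0,0)$ the set of all $(\sigma,y)$ such that $\varphi^a(t;(\sigma,y),u)=(0,0)$ for some $t\ge0$, $u\in\mathcal U$. For a family $K_\tau\subset\mathbb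 R^d$, $\tau\in[0,T)$, write $\mathcal K=\{(\tau,x): x\in K_\tau\}$ and $Y(\cdot)\mathcal K=\{(\tau,x): x\in Y(\tau)K_\tau\}$; let $\mathcal E^{\pm,0}$ be the subsets with fibers $E^{\pm,0}_\tau$, and let $\oplus$ denote the fiberwise direct sum. **Theorem.** Suppose that the system with unconstrained controls is controllable, i.e. for all $x_1,x_2\in\mathbb R^d$ and $t_0\in\mathbb R$ there are $t_1>t_0$ and an $L^\infty$ control $u$ with $\varphi(t_1;t_0,x_1,u)=x_2$. (i) $\mathbb S^1\times\{0\}\subset\operatorname{int}\mathbf R^a(0,0)$ and $$X(dT+\cdot,\cdot)\mathcal K^-\oplus\mathcal E^{+,0}\subset\operatorname{int}\mathbf R^a(0,0)\subset\mathcal K^-\oplus\mathcal E^{+,0},$$ where the sets $K^-_\tau=\operatorname{int}\mathbf R_{\mathbb NT+\tau}(0,0)\cap E^-_\tau$, $\tau\in[0,T)$, are convex and bounded uniformly in $\tau$. The sums are direct: $\mathbb R^d=E^-_\tau\oplus E^{+,0}_\tau$ and $X(dT+\tau,\tau)K^-_\tau\subset E^-_\tau$. (ii) $\mathbb S^1\times\{0\}\subset\operatorname{int}\mathbf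 C^a(0,0)$ and $$\mathcal E^{-,0}\oplus X(-dT+\cdot,\cdot)\mathcal K^+\subset\operatorname{int}\mathbf C^a(0,0)\subset\mathcal E^{-,0}\oplus\mathcal K^+,$$ where the sets $K^+_\tau=\operatorname{int}\mathbf C_{-\mathbb NT+\tau}(0,0)\cap E^+_\tau$, $\tau\in[0,T)$, are convex and bounded uniformly in $\tau$. The sums are direct: $\mathbb R^d=E^{-,0}_\tau\oplus E^+_\tau$ and $X(-dT+\tau,\tau)K^+_\tau\subset E^+_\tau$. -/

import Mathlib

open MeasureTheory Set Topology

noncomputable section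

namespace PeriodicLinear

/-- The state space and control spaces: Euclidean space of dimension `d`. Matrix functions are
written as functions with values in the (continuous) linear maps between Euclidean spaces. -/
abbrev E (d : ℕ) : Type := EuclideanSpace ℝ (Fin d)

/-- `f : ℝ → V` is in `L^∞` and `T`-periodic (almost everywhere, as for all `L^∞` objects). -/
def IsPeriodicLinfty {V : Type*} [NormedAddCommGroup V] (T : ℝ) (f : ℝ → V) : Prop :=
  MemLp f ⊤ volume ∧ ∀ᵐ t, f (t + T) = f t

/-- The admissible controls with values in `U`. With `U = univ` these are the unconstrained
controls. -/
def controls {m : ℕ} (U : Set (E m)) : Set (ℝ → E m) :=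
  {u | MemLp u ⊤ volume ∧ ∀ᵐ t, u t ∈ U}

/-- `ξ` is a solution on `ℝ`, in the sense of Caratheodory, of `ξ' = A ξ + B u`. -/
def IsSolution {d m : ℕ} (A : ℝ → E d →L[ℝ] E d) (B : ℝ → E m →L[ℝ] E d) (u : ℝ → E m)
    (ξ : ℝ → E d) : Prop :=
  Continuous ξ ∧ ∀ s t : ℝ, ξ t - ξ s = ∫ r in s..t, (A r (ξ r) + B r (u r))

/-- `X (t, s)` is the principal fundamental solution of `x' = A x`: for every `s`, the function
`t ↦ X (t, s)` is the (Caratheodory) solution of `∂X/∂t = A X` with `X (s, s) = I`. -/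
def IsPrincipalFundamental {d : ℕ} (A : ℝ → E d →L[ℝ] E d)
    (X : ℝ → ℝ → E d →L[ℝ] E d) : Prop :=
  ∀ s : ℝ, Continuous (fun t => X t s) ∧
    ∀ t : ℝ, X t s = ContinuousLinearMap.id ℝ (E d) + ∫ r in s..t, (A r) ∘L (X r s)

/-- The principal fundamental solution `X (t, s)` of `x' = A x`. It exists and is unique for `A` in
`L^∞`, see `fundamental_spec` and `fundamental_unique`. -/
def fundamental {d : ℕ} (A : ℝ → E d →L[ℝ] E d) : ℝ → ℝ → E d →L[ℝ] E d :=
  Classical.epsilon (IsPrincipalFundamental A)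

section Wellposed

variable {d : ℕ} {A : ℝ → E d →L[ℝ] E d}

theorem exists_ae_bound (hA : MemLp A ⊤ volume) : ∃ M : ℝ, 0 ≤ M ∧ ∀ᵐ t, ‖A t‖ ≤ M := by
  refine ⟨(eLpNormEssSup A volume).toReal, ENNReal.toReal_nonneg, ?_⟩
  have hfin : eLpNormEssSup A volume ≠ ⊤ := by
    have := hA.2
    rw [eLpNorm_exponent_top] at this
    exact this.ne
  filter_upwards [ae_le_eLpNormEssSup (f := A) (μ := volume)] with t ht
  have := ENNReal.toReal_mono hfin ht
  simpa using this

theorem intervalIntegrable_comp (hA : MemLp A ⊤ volume) {Y : ℝ → E d →L[ℝ] E d}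
    (hY : Continuous Y) (s t : ℝ) :
    IntervalIntegrable (fun r => (A r) ∘L (Y r)) volume s t := by
  obtain ⟨M, hM, hb⟩ := exists_ae_bound hA
  have hi : IntervalIntegrable (fun r => M * ‖Y r‖) volume s t :=
    (continuous_const.mul hY.norm).intervalIntegrable s t
  refine hi.mono_fun' ?_ ?_
  · exact (hA.1.mul hY.aestronglyMeasurable).restrict
  · refine ae_restrict_of_ae ?_
    filter_upwards [hb] with r hr
    exact (ContinuousLinearMap.opNorm_comp_le _ _).trans
      (mul_le_mul_of_nonneg_right hr (norm_nonneg _))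

theorem norm_integral_comp_le {M C : ℝ} (hM : 0 ≤ M) (hb : ∀ᵐ t, ‖A t‖ ≤ M)
    {Y : ℝ → E d →L[ℝ] E d} {s t : ℝ} {n : ℕ}
    (h : ∀ r ∈ uIoc s t, ‖Y r‖ ≤ C * ((M * |r - s|) ^ n / n.factorial)) :
    ‖∫ r in s..t, (A r) ∘L (Y r)‖ ≤ C * ((M * |t - s|) ^ (n + 1) / (n + 1).factorial) := by
  have hi : IntegrableOn (fun r => M * (C * ((M * |r - s|) ^ n / n.factorial))) (uIoc s t) := by
    rw [← intervalIntegrable_iff]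
    exact Continuous.intervalIntegrable (by fun_prop) s t
  calc ‖∫ r in s..t, (A r) ∘L (Y r)‖
      = ‖∫ r in uIoc s t, (A r) ∘L (Y r)‖ := intervalIntegral.norm_intervalIntegral_eq _ _ _ _
    _ ≤ ∫ r in uIoc s t, M * (C * ((M * |r - s|) ^ n / n.factorial)) := by
        refine norm_integral_le_of_norm_le hi ?_
        filter_upwards [ae_restrict_of_ae hb, ae_restrict_mem measurableSet_uIoc] with r hr hr'
        exact (ContinuousLinearMap.opNorm_comp_le _ _).trans
          (mul_le_mul hr (h r hr') (norm_nonneg _) hM)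
    _ = (M * (C * (M ^ n / n.factorial))) * ∫ r in uIoc s t, |r - s| ^ n := by
        rw [← integral_const_mul]
        congr 1
        ext r
        rw [mul_pow]
        ring
    _ = C * ((M * |t - s|) ^ (n + 1) / (n + 1).factorial) := by
        rw [integral_pow_abs_sub_uIoc, Nat.factorial_succ]
        push_cast
        have : (n.factorial : ℝ) ≠ 0 := by positivity
        field_simp
        ring

/-- The terms of the Peano-Baker series. -/
def peanoBaker (A : ℝ → E d →L[ℝ] E d) (s : ℝ) : ℕ → ℝ → E d →L[ℝ] E d
  | 0 => fun _ => ContinuousLinearMap.id ℝ (E d)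
  | n + 1 => fun t => ∫ r in s..t, (A r) ∘L (peanoBaker A s n r)

theorem continuous_peanoBaker (hA : MemLp A ⊤ volume) (s : ℝ) (n : ℕ) :
    Continuous (peanoBaker A s n) := by
  induction n with
  | zero => exact continuous_const
  | succ n ih =>
    exact intervalIntegral.continuous_primitive (fun a b => intervalIntegrable_comp hA ih a b) s

theorem norm_peanoBaker_le {M : ℝ} (hM : 0 ≤ M) (hb : ∀ᵐ t, ‖A t‖ ≤ M) (s : ℝ) (n : ℕ) (t : ℝ) :
    ‖peanoBaker A s n t‖ ≤ 1 * ((M * |t - s|) ^ n / n.factorial) := by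
  induction n generalizing t with
  | zero => simpa [peanoBaker] using ContinuousLinearMap.norm_id_le
  | succ n ih => exact norm_integral_comp_le hM hb (fun r _ => ih r)

theorem exists_fundamental (hA : MemLp A ⊤ volume) : ∃ X, IsPrincipalFundamental A X := by
  obtain ⟨M, hM, hb⟩ := exists_ae_bound hA
  refine ⟨fun t s => ∑' n, peanoBaker A s n t, fun s => ?_⟩
  have hle : ∀ R : ℝ, ∀ n : ℕ, ∀ t : ℝ, |t - s| ≤ R →
      ‖peanoBaker A s n t‖ ≤ (M * R) ^ n / n.factorial := by
    intro R n t ht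
    refine (norm_peanoBaker_le hM hb s n t).trans ?_
    rw [one_mul]
    gcongr
  have hsum : ∀ t, Summable (fun n => peanoBaker A s n t) := fun t =>
    Summable.of_norm_bounded (Real.summable_pow_div_factorial (M * |t - s|))
      (fun n => hle _ n t le_rfl)
  have hcont : Continuous (fun t => ∑' n, peanoBaker A s n t) := by
    rw [continuous_iff_continuousAt]
    intro t₀
    have hon : ContinuousOn (fun t => ∑' n, peanoBaker A s n t) (Metric.ball s (|t₀ - s| + 1)) := by
      refine continuousOn_tsum (fun n => (continuous_peanoBaker hA s n).continuousOn)
        (Real.summable_pow_div_factorial (M * (|t₀ - s| + 1))) (fun n t ht => hle _ n t ?_)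
      rw [Metric.mem_ball, Real.dist_eq] at ht
      exact ht.le
    refine hon.continuousAt (Metric.isOpen_ball.mem_nhds ?_)
    rw [Metric.mem_ball, Real.dist_eq]
    linarith
  refine ⟨hcont, fun t => ?_⟩
  have hint : HasSum (fun n => ∫ r in s..t, (A r) ∘L (peanoBaker A s n r))
      (∫ r in s..t, (A r) ∘L (∑' n, peanoBaker A s n r)) := by
    refine intervalIntegral.hasSum_integral_of_dominated_convergence
      (fun n _ => M * ((M * |t - s|) ^ n / n.factorial)) (fun n => ?_) (fun n => ?_) ?_ ?_ ?_
    · exact (hA.1.mul (continuous_peanoBaker hA s n).aestronglyMeasurable).restrict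
    · filter_upwards [hb] with r hr hr'
      refine (ContinuousLinearMap.opNorm_comp_le _ _).trans
        (mul_le_mul hr (hle _ n r ?_) (norm_nonneg _) hM)
      exact Set.abs_sub_left_of_mem_uIcc (Set.uIoc_subset_uIcc hr')
    · exact Filter.Eventually.of_forall fun r _ =>
        (Real.summable_pow_div_factorial (M * |t - s|)).mul_left M
    · exact intervalIntegrable_const
    · exact Filter.Eventually.of_forall fun r _ => (hsum r).hasSum.mul_left (A r)
  have h1 := (hsum t).tsum_eq_zero_add
  have h2 := hint.tsum_eq
  simp only [peanoBaker] at h1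
  rw [← h2]
  exact h1

theorem fundamental_spec (hA : MemLp A ⊤ volume) : IsPrincipalFundamental A (fundamental A) :=
  Classical.epsilon_spec (exists_fundamental hA)

theorem fundamental_unique (hA : MemLp A ⊤ volume) {X : ℝ → ℝ → E d →L[ℝ] E d}
    (hX : IsPrincipalFundamental A X) : X = fundamental A := by
  obtain ⟨M, hM, hb⟩ := exists_ae_bound hA
  have hF := fundamental_spec hA
  funext t s
  obtain ⟨C, hC⟩ := (isCompact_uIcc (a := s) (b := t)).exists_bound_of_continuousOn
    (((hX s).1.sub (hF s).1).continuousOn)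
  have key : ∀ n : ℕ, ∀ r ∈ uIcc s t,
      ‖X r s - fundamental A r s‖ ≤ C * ((M * |r - s|) ^ n / n.factorial) := by
    intro n
    induction n with
    | zero => intro r hr; simpa using hC r hr
    | succ n ih =>
      intro r hr
      have heq : X r s - fundamental A r s
          = ∫ q in s..r, (A q) ∘L (X q s - fundamental A q s) := by
        rw [(hX s).2 r, (hF s).2 r, add_sub_add_left_eq_sub, ← intervalIntegral.integral_sub
          (intervalIntegrable_comp hA (hX s).1 s r) (intervalIntegrable_comp hA (hF s).1 s r)]
        simp only [ContinuousLinearMap.comp_sub]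
      rw [heq]
      exact norm_integral_comp_le hM hb fun q hq =>
        ih q (uIcc_subset_uIcc_left hr (uIoc_subset_uIcc hq))
  have hlim : Filter.Tendsto (fun n : ℕ => C * ((M * |t - s|) ^ n / n.factorial)) Filter.atTop
      (𝓝 (C * 0)) := (FloorSemiring.tendsto_pow_div_factorial_atTop _).const_mul C
  have := ge_of_tendsto' hlim (fun n => key n t right_mem_uIcc)
  rw [mul_zero] at this
  exact sub_eq_zero.mp (norm_le_zero_iff.mp this)

end Wellposed

/-- Reachable set at time `t ≥ t₀` from `(t₀, x)` (empty for `t < t₀`). -/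
def reachAt {d m : ℕ} (A : ℝ → E d →L[ℝ] E d) (B : ℝ → E m →L[ℝ] E d) (U : Set (E m))
    (t t₀ : ℝ) (x : E d) : Set (E d) :=
  {y | t₀ ≤ t ∧ ∃ u ∈ controls U, ∃ ξ, IsSolution A B u ξ ∧ ξ t₀ = x ∧ ξ t = y}

/-- Controllable set at time `t ≤ t₀` to `(t₀, x)` (empty for `t > t₀`). -/
def ctrlAt {d m : ℕ} (A : ℝ → E d →L[ℝ] E d) (B : ℝ → E m →L[ℝ] E d) (U : Set (E m))
    (t t₀ : ℝ) (x : E d) : Set (E d) :=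
  {y | t ≤ t₀ ∧ ∃ u ∈ controls U, ∃ ξ, IsSolution A B u ξ ∧ ξ t = y ∧ ξ t₀ = x}

/-- The set `R_{ℕT+τ}(0, 0)`. -/
def reachPeriods {d m : ℕ} (T : ℝ) (A : ℝ → E d →L[ℝ] E d) (B : ℝ → E m →L[ℝ] E d)
    (U : Set (E m)) (τ : ℝ) : Set (E d) :=
  ⋃ k : ℕ, reachAt A B U (k * T + τ) 0 0

/-- The set `C_{-ℕT+τ}(0, 0)`. For `τ ∈ (0, T)` the index `k = 0` contributes nothing, since
controllable sets are only formed at times `≤ 0` here. -/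
def ctrlPeriods {d m : ℕ} (T : ℝ) (A : ℝ → E d →L[ℝ] E d) (B : ℝ → E m →L[ℝ] E d)
    (U : Set (E m)) (τ : ℝ) : Set (E d) :=
  ⋃ k : ℕ, ctrlAt A B U (-(k * T) + τ) 0 0

/-- The system with unconstrained (essentially bounded) controls is controllable. -/
def Controllable {d m : ℕ} (A : ℝ → E d →L[ℝ] E d) (B : ℝ → E m →L[ℝ] E d) : Prop :=
  ∀ (x₁ x₂ : E d) (t₀ : ℝ), ∃ t₁ > t₀, x₂ ∈ reachAt A B univ t₁ t₀ x₁

/-! Floquet theory -/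

/-- The complexification of a real linear map, in standard coordinates. -/
def complexify {d : ℕ} (M : E d →L[ℝ] E d) : Module.End ℂ (Fin d → ℂ) :=
  Matrix.toLin' ((LinearMap.toMatrix (EuclideanSpace.basisFun (Fin d) ℝ).toBasis
    (EuclideanSpace.basisFun (Fin d) ℝ).toBasis (M : E d →ₗ[ℝ] E d)).map (algebraMap ℝ ℂ))

/-- Coordinatewise real part. -/
def rePart (d : ℕ) : (Fin d → ℂ) →ₗ[ℝ] E d :=
  (WithLp.linearEquiv 2 ℝ (Fin d → ℝ)).symm.toLinearMap ∘ₗ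
    LinearMap.pi (fun i => Complex.reLm ∘ₗ LinearMap.proj i)

/-- The real generalized eigenspace of `M` for `μ ∈ ℂ`: the real parts of the elements of the
complex generalized eigenspace. -/
def realGenEigenspace {d : ℕ} (M : E d →L[ℝ] E d) (μ : ℂ) : Submodule ℝ (E d) :=
  (((complexify M).maxGenEigenspace μ).restrictScalars ℝ).map (rePart d)

/-- The Floquet space `L(ν, τ)`: the sum of the real generalized eigenspaces of `X(T+τ, τ)` for the
Floquet multipliers `μ` with `(1/T) log |μ| = ν` (zero if `ν` is not a Floquet exponent). -/
def floquetSpace {d : ℕ} (T : ℝ) (A : ℝ → E d →L[ℝ] E d) (ν τ : ℝ) : Submodule ℝ (E d) :=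
  ⨆ μ ∈ {μ : ℂ | (complexify (fundamental A (T + τ) τ)).HasEigenvalue μ ∧
      1 / T * Real.log ‖μ‖ = ν},
    realGenEigenspace (fundamental A (T + τ) τ) μ

/-- Stable subspace `E⁻_τ`. -/
def stable {d : ℕ} (T : ℝ) (A : ℝ → E d →L[ℝ] E d) (τ : ℝ) : Submodule ℝ (E d) :=
  ⨆ ν ∈ Iio (0 : ℝ), floquetSpace T A ν τ

/-- Unstable subspace `E⁺_τ`. -/
def unstable {d : ℕ} (T : ℝ) (A : ℝ → E d →L[ℝ] E d) (τ : ℝ) : Submodule ℝ (E d) :=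
  ⨆ ν ∈ Ioi (0 : ℝ), floquetSpace T A ν τ

/-- Center-stable subspace `E^{-,0}_τ`. -/
def centerStable {d : ℕ} (T : ℝ) (A : ℝ → E d →L[ℝ] E d) (τ : ℝ) : Submodule ℝ (E d) :=
  ⨆ ν ∈ Iic (0 : ℝ), floquetSpace T A ν τ

/-- Center-unstable subspace `E^{+,0}_τ`. -/
def centerUnstable {d : ℕ} (T : ℝ) (A : ℝ → E d →L[ℝ] E d) (τ : ℝ) : Submodule ℝ (E d) :=
  ⨆ ν ∈ Ici (0 : ℝ), floquetSpace T A ν τ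

/-! The autonomized system on `S¹ × ℝ^d`, where `S¹ = ℝ / Tℤ` -/

/-- The representative in `[0, T)` of a point of the circle. -/
def phase (T : ℝ) [Fact (0 < T)] (σ : AddCircle T) : ℝ :=
  (AddCircle.equivIco T 0 σ : ℝ)

/-- `η` is the trajectory `t ↦ (τ₀ + t mod T, φ(τ₀ + t; τ₀, x₀, u))` of the autonomized system
with initial state `p = (τ₀, x₀)`. -/
def IsAutTrajectory {d m : ℕ} (T : ℝ) [Fact (0 < T)] (A : ℝ → E d →L[ℝ] E d)
    (B : ℝ → E m →L[ℝ] E d) (u : ℝ → E m) (p : AddCircle T × E d)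
    (η : ℝ → AddCircle T × E d) : Prop :=
  ∃ ξ, IsSolution A B u ξ ∧ ξ (phase T p.1) = p.2 ∧
    ∀ t, η t = (((phase T p.1 + t : ℝ) : AddCircle T), ξ (phase T p.1 + t))

/-- Reachable set of the autonomized system from `p`. -/
def autReach {d m : ℕ} (T : ℝ) [Fact (0 < T)] (A : ℝ → E d →L[ℝ] E d)
    (B : ℝ → E m →L[ℝ] E d) (U : Set (E m)) (p : AddCircle T × E d) :
    Set (AddCircle T × E d) :=
  {q | ∃ t ≥ (0 : ℝ), ∃ u ∈ controls U, ∃ η, IsAutTrajectory T A B u p η ∧ η t = q}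

/-- Controllable set of the autonomized system to `p`. -/
def autCtrl {d m : ℕ} (T : ℝ) [Fact (0 < T)] (A : ℝ → E d →L[ℝ] E d)
    (B : ℝ → E m →L[ℝ] E d) (U : Set (E m)) (p : AddCircle T × E d) :
    Set (AddCircle T × E d) :=
  {q | ∃ t ≥ (0 : ℝ), ∃ u ∈ controls U, ∃ η, IsAutTrajectory T A B u q η ∧ η t = p}

/-- The subset of `S¹ × ℝ^d` with fiber `K τ` over each `τ ∈ [0, T)`. -/
def bundle {d : ℕ} (T : ℝ) [Fact (0 < T)] (K : ℝ → Set (E d)) : Set (AddCircle T × E d) :=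
  {p | p.2 ∈ K (phase T p.1)}

/-- Fiberwise sum of subsets of `S¹ × ℝ^d`. -/
def fiberSum {d : ℕ} {T : ℝ} (V W : Set (AddCircle T × E d)) : Set (AddCircle T × E d) :=
  {p | ∃ v w : E d, (p.1, v) ∈ V ∧ (p.1, w) ∈ W ∧ p.2 = v + w}

/-- `K⁻_τ = int R_{ℕT+τ}(0, 0) ∩ E⁻_τ`. -/
def KMinus {d m : ℕ} (T : ℝ) (A : ℝ → E d →L[ℝ] E d) (B : ℝ → E m →L[ℝ] E d)
    (U : Set (E m)) (τ : ℝ) : Set (E d) :=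
  interior (reachPeriods T A B U τ) ∩ (stable T A τ : Set (E d))

/-- `K⁺_τ = int C_{-ℕT+τ}(0, 0) ∩ E⁺_τ`. -/
def KPlus {d m : ℕ} (T : ℝ) (A : ℝ → E d →L[ℝ] E d) (B : ℝ → E m →L[ℝ] E d)
    (U : Set (E m)) (τ : ℝ) : Set (E d) :=
  interior (ctrlPeriods T A B U τ) ∩ (unstable T A τ : Set (E d))

end PeriodicLinear

end

open MeasureTheory Set Topology

noncomputable section

namespace PeriodicLinear

/-! ### Real spectral subspaces through the complexification. -/

section Spectral

variable {d : ℕ}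

/-! Fix a phase `τ`, let `S` be the union of the reachable sets at the times `kT + τ`, and let `M`
be the monodromy map at `τ`. Periodicity and `0 ∈ U` make this union increasing, so `S` is convex.
Controllability and a dimension argument (`exists_forall_mem_reachAt`) give one `n` for which all
states are reached from 0 in `n` periods without constraints. By linearity the constrained controls
then reach a neighborhood `V` of 0, and `M^n a + v ∈ S` for `a ∈ S`, `v ∈ V`.

This recursion forces the center-unstable space into `int S` (`spectralSubspace_subset_interior`). A
functional `f` separating a point from `int S` is bounded above on all sums of `M^(nj) v_j` with
`v_j ∈ V`. Choosing signs makes the sequence `f (M^(nj) y)` absolutely summable for every `y`, hence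
null, so `f` vanishes on the generalized eigenspaces with `|μ| ≥ 1`, a contradiction there. By
convexity `int S` is invariant under translation by the center-unstable space, so it splits as `K⁻ ⊕
E^{+,0}` along the spectral decomposition.

The fiber over `τ` of the reachable set of the autonomized system is `S`. An interior point of the
total set is interior in its fiber, which gives the upper inclusion. For the lower one, flow freely
for at least one period: the time slack absorbs small changes of the phase
(`coe_mem_interior_autReach`). The bound on `K⁻` comes from writing reachable points as sums of `M^j
r_j` with bounded `r_j` and projecting to the stable space, where the powers are summable
(`exists_bound_KMinus`).

The second half is the first half for the time-reversed system at phase `-τ`: reachable and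
controllable sets are exchanged, and so are stable and unstable spaces. What is passed to the
reversed system is `PeriodReachable`, not the controllability hypothesis itself. -/

theorem complexify_mul (M N : E d →L[ℝ] E d) :
    complexify (M ∘L N) = complexify M * complexify N := by
  unfold complexify
  rw [ContinuousLinearMap.toLinearMap_comp,
    LinearMap.toMatrix_comp _ (EuclideanSpace.basisFun (Fin d) ℝ).toBasis, Matrix.map_mul,
    Matrix.toLin'_mul]
  rfl

theorem complexify_id : complexify (ContinuousLinearMap.id ℝ (E d)) = 1 := by
  unfold complexify
  rw [ContinuousLinearMap.coe_id, LinearMap.toMatrix_id]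
  simp
  rfl

theorem complexify_apply (M : E d →L[ℝ] E d) (z : Fin d → ℂ) (i : Fin d) :
    complexify M z i = ∑ j, (M (EuclideanSpace.single j 1) i : ℂ) * z j := by
  simp [complexify, Matrix.mulVec, dotProduct, LinearMap.toMatrix_apply]

theorem apply_eq_sum (M : E d →L[ℝ] E d) (x : E d) (i : Fin d) :
    M x i = ∑ j, M (EuclideanSpace.single j 1) i * x j := by
  conv_lhs => rw [← (EuclideanSpace.basisFun (Fin d) ℝ).sum_repr x]
  simp [mul_comm]

@[simp] theorem rePart_apply (z : Fin d → ℂ) (i : Fin d) : rePart d z i = (z i).re := rfl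

theorem rePart_complexify (M : E d →L[ℝ] E d) (z : Fin d → ℂ) :
    rePart d (complexify M z) = M (rePart d z) := by
  ext i
  rw [rePart_apply, complexify_apply, apply_eq_sum]
  simp

/-- The inclusion of real vectors in the complexification. -/
def ofRealVec (d : ℕ) : E d →ₗ[ℝ] (Fin d → ℂ) where
  toFun x i := (x i : ℂ)
  map_add' x y := by ext i; simp
  map_smul' c x := by ext i; simp

@[simp] theorem ofRealVec_apply (x : E d) (i : Fin d) : ofRealVec d x i = (x i : ℂ) := rfl

@[simp] theorem rePart_ofRealVec (x : E d) : rePart d (ofRealVec d x) = x := by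
  ext i; simp

theorem ofRealVec_injective : Function.Injective (ofRealVec d) :=
  Function.LeftInverse.injective rePart_ofRealVec

theorem complexify_star (M : E d →L[ℝ] E d) (z : Fin d → ℂ) :
    complexify M (star z) = star (complexify M z) := by
  ext i
  simp [complexify_apply]

theorem ofRealVec_rePart (z : Fin d → ℂ) :
    ofRealVec d (rePart d z) = (1 / 2 : ℂ) • (z + star z) := by
  ext i
  simp [Complex.re_eq_add_conj]
  ring

theorem mem_maxGen_iff (M : E d →L[ℝ] E d) (μ : ℂ) (z : Fin d → ℂ) :
    z ∈ (complexify M).maxGenEigenspace μ ↔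
      ∃ k : ℕ, ((complexify M - algebraMap ℂ _ μ) ^ k) z = 0 := by
  rw [Module.End.mem_maxGenEigenspace]
  rfl

/-- The matrix of `M` is real, so conjugation turns `M - μ` into `M - star μ`. -/
theorem star_mem_maxGen {M : E d →L[ℝ] E d} {μ : ℂ} {z : Fin d → ℂ}
    (hz : z ∈ (complexify M).maxGenEigenspace μ) :
    star z ∈ (complexify M).maxGenEigenspace (star μ) := by
  rw [mem_maxGen_iff] at hz ⊢
  obtain ⟨k, hk⟩ := hz
  refine ⟨k, ?_⟩
  have key : ∀ k : ℕ, ∀ w : Fin d → ℂ, ((complexify M - algebraMap ℂ _ (star μ)) ^ k) (star w) =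
      star (((complexify M - algebraMap ℂ _ μ) ^ k) w) := by
    intro k
    induction k with
    | zero => intro w; rfl
    | succ k ih =>
      intro w
      rw [pow_succ, pow_succ, Module.End.mul_apply, Module.End.mul_apply, ← ih]
      congr 1
      simp [complexify_star, LinearMap.sub_apply, Module.algebraMap_end_apply]
  rw [key, hk, star_zero]

/-- The sum of the real generalized eigenspaces for the `μ ∈ s`. -/
def spectralSubspace (M : E d →L[ℝ] E d) (s : Set ℂ) : Submodule ℝ (E d) :=
  ⨆ μ ∈ s, realGenEigenspace M μ

theorem realGenEigenspace_le {M : E d →L[ℝ] E d} {s : Set ℂ} {μ : ℂ} (h : μ ∈ s) :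
    realGenEigenspace M μ ≤ spectralSubspace M s :=
  le_biSup (realGenEigenspace M) h

theorem spectralSubspace_le_iff {M : E d →L[ℝ] E d} {s : Set ℂ} {P : Submodule ℝ (E d)} :
    spectralSubspace M s ≤ P ↔
      ∀ μ ∈ s, ∀ z ∈ (complexify M).maxGenEigenspace μ, rePart d z ∈ P := by
  refine ⟨fun h μ hμ z hz => h (realGenEigenspace_le hμ ⟨z, hz, rfl⟩), fun h => ?_⟩
  refine iSup₂_le fun μ hμ => ?_
  rintro _ ⟨z, hz, rfl⟩
  exact h μ hμ z hz

theorem spectralSubspace_sup_compl (M : E d →L[ℝ] E d) (s : Set ℂ) :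
    spectralSubspace M s ⊔ spectralSubspace M sᶜ = ⊤ := by
  rw [eq_top_iff]
  intro x _
  have hx : ofRealVec d x ∈ ⨆ μ, (complexify M).maxGenEigenspace μ := by
    rw [Module.End.iSup_maxGenEigenspace_eq_top]
    trivial
  rw [← rePart_ofRealVec x]
  refine Submodule.iSup_induction _ (motive := fun z => rePart d z ∈ _) hx (fun μ z hz => ?_) ?_ ?_
  · have hmem : rePart d z ∈ realGenEigenspace M μ := ⟨z, hz, rfl⟩
    by_cases h : μ ∈ s
    · exact Submodule.mem_sup_left (realGenEigenspace_le h hmem)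
    · exact Submodule.mem_sup_right (realGenEigenspace_le (s := sᶜ) h hmem)
  · simp
  · intro y z hy hz
    rw [map_add]
    exact add_mem hy hz

/-- The real part of `z` is `(z + star z) / 2`, and conjugation symmetry of `s` keeps both terms in
the complex sum. This carries disjointness from the complex eigenspaces back to the real ones. -/
theorem ofRealVec_mem {M : E d →L[ℝ] E d} {s : Set ℂ} (hs : ∀ μ ∈ s, star μ ∈ s) {x : E d}
    (hx : x ∈ spectralSubspace M s) :
    ofRealVec d x ∈ ⨆ μ ∈ s, (complexify M).maxGenEigenspace μ := by
  have : spectralSubspace M s ≤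
      ((⨆ μ ∈ s, (complexify M).maxGenEigenspace μ).restrictScalars ℝ).comap (ofRealVec d) := by
    rw [spectralSubspace_le_iff]
    intro μ hμ z hz
    rw [Submodule.mem_comap, Submodule.restrictScalars_mem, ofRealVec_rePart]
    exact Submodule.smul_mem _ _ (add_mem
      (le_biSup (complexify M).maxGenEigenspace hμ hz)
      (le_biSup (complexify M).maxGenEigenspace (hs μ hμ) (star_mem_maxGen hz)))
  exact this hx

theorem spectralSubspace_isCompl (M : E d →L[ℝ] E d) {s : Set ℂ} (hs : ∀ μ, star μ ∈ s ↔ μ ∈ s) :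
    IsCompl (spectralSubspace M s) (spectralSubspace M sᶜ) := by
  refine ⟨?_, codisjoint_iff.mpr (spectralSubspace_sup_compl M s)⟩
  rw [Submodule.disjoint_def]
  intro x h1 h2
  have hd : Disjoint (⨆ μ ∈ s, (complexify M).maxGenEigenspace μ)
      (⨆ μ ∈ sᶜ, (complexify M).maxGenEigenspace μ) :=
    (Module.End.independent_maxGenEigenspace (complexify M)).disjoint_biSup_biSup
      disjoint_compl_right
  rw [Submodule.disjoint_def] at hd
  have := hd _ (ofRealVec_mem (fun μ h => (hs μ).2 h) h1)
    (ofRealVec_mem (s := sᶜ) (fun μ h hμ => h ((hs μ).1 hμ)) h2)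
  exact ofRealVec_injective (this.trans (map_zero _).symm)

/-- An intertwiner carries kernels of `(M - μ)^k` into kernels of `(M' - μ)^k`. It is used for the
transport of Floquet spaces from one phase to another. -/
theorem map_mem_spectralSubspace {M M' S : E d →L[ℝ] E d} (h : S ∘L M = M' ∘L S) {s : Set ℂ}
    {x : E d} (hx : x ∈ spectralSubspace M s) : S x ∈ spectralSubspace M' s := by
  have hc : ∀ z, complexify S (complexify M z) = complexify M' (complexify S z) := fun z => by
    simpa [complexify_mul] using LinearMap.congr_fun (congrArg complexify h) z
  have : spectralSubspace M s ≤ (spectralSubspace M' s).comap (S : E d →ₗ[ℝ] E d) := by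
    rw [spectralSubspace_le_iff]
    intro μ hμ z hz
    refine realGenEigenspace_le hμ ⟨complexify S z, ?_, rePart_complexify S z⟩
    rw [SetLike.mem_coe, Submodule.restrictScalars_mem, mem_maxGen_iff]
    rw [mem_maxGen_iff] at hz
    obtain ⟨k, hk⟩ := hz
    refine ⟨k, ?_⟩
    have key : ∀ k : ℕ, ∀ w, ((complexify M' - algebraMap ℂ _ μ) ^ k) (complexify S w) =
        complexify S (((complexify M - algebraMap ℂ _ μ) ^ k) w) := by
      intro k
      induction k with
      | zero => intro w; rfl
      | succ k ih =>
        intro w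
        rw [pow_succ, pow_succ, Module.End.mul_apply, Module.End.mul_apply, ← ih]
        congr 1
        simp [LinearMap.sub_apply, Module.algebraMap_end_apply, hc]
    rw [key, hk, map_zero]
  exact this hx

/-- With `N` the inverse of `M`, `N - μ⁻¹ = -μ⁻¹ N (M - μ)` and the factors commute, so powers of
both sides kill the same vectors. For `μ = 0` the generalized eigenspace is trivial. -/
theorem spectralSubspace_le_inv {M N : E d →L[ℝ] E d} (hNM : N ∘L M = .id ℝ _)
    (hMN : M ∘L N = .id ℝ _) {s t : Set ℂ} (hst : ∀ μ ∈ s, μ ≠ 0 → μ⁻¹ ∈ t) :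
    spectralSubspace M s ≤ spectralSubspace N t := by
  have h1 : complexify N * complexify M = 1 := by rw [← complexify_mul, hNM, complexify_id]
  have h2 : complexify M * complexify N = 1 := by rw [← complexify_mul, hMN, complexify_id]
  rw [spectralSubspace_le_iff]
  intro μ hμ z hz
  rw [mem_maxGen_iff] at hz
  obtain ⟨k, hk⟩ := hz
  have hcomm : ∀ c : ℂ, Commute (complexify N) (complexify M - algebraMap ℂ _ c) := fun c =>
    (show Commute _ _ from h1.trans h2.symm).sub_right (Algebra.commutes c _).symm
  have hNk : (((complexify N) * (complexify M - algebraMap ℂ _ μ)) ^ k) z = 0 := by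
    rw [(hcomm μ).mul_pow, Module.End.mul_apply, hk, map_zero]
  by_cases h0 : μ = 0
  · subst h0
    rw [map_zero, sub_zero, h1, one_pow] at hNk
    rw [show z = 0 from hNk, map_zero]
    exact zero_mem _
  · refine realGenEigenspace_le (hst μ hμ h0) ⟨z, ?_, rfl⟩
    rw [SetLike.mem_coe, Submodule.restrictScalars_mem, mem_maxGen_iff]
    refine ⟨k, ?_⟩
    have : complexify N - algebraMap ℂ _ μ⁻¹ =
        (-μ⁻¹) • (complexify N * (complexify M - algebraMap ℂ _ μ)) := by
      rw [mul_sub, h1, smul_sub, Algebra.algebraMap_eq_smul_one, Algebra.algebraMap_eq_smul_one,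
        mul_smul_comm, mul_one, smul_smul]
      rw [neg_mul, inv_mul_cancel₀ h0]
      module
    rw [this, smul_pow, LinearMap.smul_apply, hNk, smul_zero]

/-- Eigenvalues may be dropped from an index set when they do not occur. -/
theorem iSup_floquet_eq {M : E d →L[ℝ] E d} (hM : Function.Injective M) {T : ℝ}
    (I : Set ℝ) (s : Set ℂ) (h : ∀ μ : ℂ, μ ≠ 0 → (Real.log ‖μ‖ / T ∈ I ↔ μ ∈ s)) :
    (⨆ ν ∈ I, ⨆ μ ∈ {μ : ℂ | (complexify M).HasEigenvalue μ ∧ 1 / T * Real.log ‖μ‖ = ν},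
      realGenEigenspace M μ) = spectralSubspace M s := by
  -- Since `Real.log 0 = 0`, a multiplier 0 would be counted with exponent 0. Injectivity of `M`
  -- rules it out, which is why `h` is needed for `μ ≠ 0` only.
  have hinj : ∀ z, complexify M z = 0 → z = 0 := by
    intro z hz
    have hre : ∀ w, complexify M w = 0 → rePart d w = 0 := fun w hw =>
      hM (by rw [← rePart_complexify, hw, map_zero, map_zero])
    have h1 := hre z hz
    have h2 := hre (Complex.I • z) (by rw [map_smul, hz, smul_zero])
    ext i
    have e1 := congrArg (fun x : E d => x i) h1
    have e2 := congrArg (fun x : E d => x i) h2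
    simp at e1 e2
    exact Complex.ext e1 e2
  have hne : ∀ μ, (complexify M).HasEigenvalue μ → μ ≠ 0 := by
    rintro μ hμ rfl
    obtain ⟨z, hz⟩ := hμ.exists_hasEigenvector
    exact hz.2 (hinj z (by simpa using hz.apply_eq_smul))
  apply le_antisymm
  · refine iSup₂_le fun ν hν => iSup₂_le fun μ hμ => realGenEigenspace_le ?_
    rw [← h μ (hne μ hμ.1), div_eq_inv_mul, ← one_div, hμ.2]
    exact hν
  · refine iSup₂_le fun μ hμ => ?_
    by_cases he : (complexify M).HasEigenvalue μ
    · refine le_trans ?_ (le_biSup _ ((h μ (hne μ he)).2 hμ))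
      refine le_biSup (realGenEigenspace M) (show μ ∈ {μ : ℂ | _ ∧ _} from ⟨he, ?_⟩)
      ring
    · have hbot : (complexify M).maxGenEigenspace μ = ⊥ := by
        rw [eq_bot_iff]
        intro z hz
        rw [mem_maxGen_iff] at hz
        obtain ⟨k, hk⟩ := hz
        have hker : ∀ w, (complexify M - algebraMap ℂ _ μ) w = 0 → w = 0 := by
          intro w hw
          by_contra hw0
          refine he (Module.End.hasEigenvalue_of_hasEigenvector (x := w) ⟨?_, hw0⟩)
          rw [Module.End.mem_eigenspace_iff]
          simpa [LinearMap.sub_apply, Module.algebraMap_end_apply, sub_eq_zero] using hw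
        have hall : ∀ k : ℕ, ∀ w, ((complexify M - algebraMap ℂ _ μ) ^ k) w = 0 → w = 0 := by
          intro k
          induction k with
          | zero => intro w hw; exact hw
          | succ k ih =>
            intro w hw
            rw [pow_succ, Module.End.mul_apply] at hw
            exact hker w (ih _ hw)
        exact hall k z hk
      rw [realGenEigenspace, hbot]
      simp

end Spectral

/-! ### Powers of a map, convex absorption and separation. -/

section Dynamics

variable {d : ℕ}

theorem complexify_pow (M : E d →L[ℝ] E d) (n : ℕ) :
    complexify (M ^ n) = complexify M ^ n := by
  induction n with
  | zero => exact complexify_id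
  | succ n ih => rw [pow_succ, pow_succ, ← ih, ← complexify_mul]; rfl

/-- Induction on the height `k`: `w = (f - μ) z` has smaller height, and `f z = μ z + w` gives a
contracting recursion for the partial sums with the summable perturbation `‖f^j w‖`. -/
theorem summable_norm_pow_of_pow_sub_eq_zero {V : Type*} [NormedAddCommGroup V] [NormedSpace ℂ V]
    (f : Module.End ℂ V) {μ : ℂ} (hμ : ‖μ‖ < 1) (k : ℕ) (z : V)
    (hz : ((f - algebraMap ℂ _ μ) ^ k) z = 0) : Summable fun j : ℕ => ‖(f ^ j) z‖ := by
  induction k generalizing z with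
  | zero =>
    have : z = 0 := hz
    simp [this]
  | succ k ih =>
    set w := (f - algebraMap ℂ _ μ) z with hw
    have hsw : Summable fun j : ℕ => ‖(f ^ j) w‖ := ih w (by
      rwa [pow_succ, Module.End.mul_apply] at hz)
    have hstep : ∀ j, ‖(f ^ (j + 1)) z‖ ≤ ‖μ‖ * ‖(f ^ j) z‖ + ‖(f ^ j) w‖ := by
      intro j
      have : f z = μ • z + w := by simp [hw, LinearMap.sub_apply, Module.algebraMap_end_apply]
      rw [pow_succ, Module.End.mul_apply, this, map_add, map_smul, ← norm_smul]
      exact norm_add_le _ _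
    set C := ∑' j, ‖(f ^ j) w‖
    -- The constant is the fixed point of `s ↦ ‖μ‖ s + C + ‖z‖`, the map that dominates the passage
    -- from one partial sum to the next.
    refine summable_of_sum_range_le (c := (‖z‖ + C) / (1 - ‖μ‖)) (fun _ => norm_nonneg _) ?_
    have hpos : 0 < 1 - ‖μ‖ := by linarith
    have hC : 0 ≤ C := tsum_nonneg fun _ => norm_nonneg _
    intro n
    induction n with
    | zero =>
      rw [Finset.sum_range_zero]
      positivity
    | succ n ihn =>
      rw [Finset.sum_range_succ']
      have h1 := Finset.sum_le_sum fun j (_ : j ∈ Finset.range n) => hstep j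
      rw [Finset.sum_add_distrib, ← Finset.mul_sum] at h1
      have h2 : ∑ j ∈ Finset.range n, ‖(f ^ j) w‖ ≤ C :=
        hsw.sum_le_tsum _ fun _ _ => norm_nonneg _
      have h3 := mul_le_mul_of_nonneg_left ihn (norm_nonneg μ)
      have h4 : ‖μ‖ * ((‖z‖ + C) / (1 - ‖μ‖)) + C + ‖z‖ = (‖z‖ + C) / (1 - ‖μ‖) := by
        field_simp
        ring
      simp only [pow_zero, Module.End.one_apply]
      linarith

theorem summable_norm_pow (M : E d →L[ℝ] E d) {x : E d}
    (hx : x ∈ spectralSubspace M {μ | ‖μ‖ < 1}) : Summable fun j : ℕ => ‖(M ^ j) x‖ := by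
  let P : Submodule ℝ (E d) :=
    { carrier := {x | Summable fun j : ℕ => ‖(M ^ j) x‖}
      zero_mem' := by simp
      add_mem' := fun {x y} hx hy => (Summable.add hx hy).of_nonneg_of_le (fun _ => norm_nonneg _)
        fun j => by rw [map_add]; exact norm_add_le _ _
      smul_mem' := fun c x hx => (Summable.mul_left |c| hx).congr fun j => by
        rw [map_smul, norm_smul, Real.norm_eq_abs] }
  have : spectralSubspace M {μ | ‖μ‖ < 1} ≤ P := by
    rw [spectralSubspace_le_iff]
    intro μ hμ z hz
    rw [mem_maxGen_iff] at hz
    obtain ⟨k, hk⟩ := hz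
    have hs := summable_norm_pow_of_pow_sub_eq_zero (complexify M) hμ k z hk
    refine (hs.mul_left ‖(rePart d).toContinuousLinearMap‖).of_nonneg_of_le
      (fun _ => norm_nonneg _) fun j => ?_
    rw [← rePart_complexify, complexify_pow]
    exact (rePart d).toContinuousLinearMap.le_opNorm _
  exact this hx

/-- Let `G` be the complex extension of `f`. Once `G` vanishes on generalized eigenvectors of lower
height, `G (M^n z) = μ^n G z`, whose norm cannot tend to 0 along `n = N j` when `|μ| ≥ 1` unless `G
z = 0`. -/
theorem functional_eq_zero_of_tendsto (M : E d →L[ℝ] E d) (f : E d →L[ℝ] ℝ) (N : ℕ)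
    (hf : ∀ x, Filter.Tendsto (fun j : ℕ => f ((M ^ (N * j)) x)) Filter.atTop (𝓝 0)) {x : E d}
    (hx : x ∈ spectralSubspace M {μ | 1 ≤ ‖μ‖}) : f x = 0 := by
  let G : (Fin d → ℂ) →ₗ[ℂ] ℂ := ∑ j, (f (EuclideanSpace.single j 1) : ℂ) • LinearMap.proj j
  have hG : ∀ z, f (rePart d z) = (G z).re := by
    intro z
    conv_lhs => rw [← (EuclideanSpace.basisFun (Fin d) ℝ).sum_repr (rePart d z)]
    simp [G, mul_comm]
  have hGt : ∀ z, Filter.Tendsto (fun j : ℕ => G ((complexify M ^ (N * j)) z)) Filter.atTop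
      (𝓝 0) := by
    intro z
    have hre : ∀ z, Filter.Tendsto (fun j : ℕ => (G ((complexify M ^ (N * j)) z)).re) Filter.atTop
        (𝓝 0) := by
      intro z
      simpa only [← hG, ← complexify_pow, rePart_complexify] using hf (rePart d z)
    -- The real part of `G` at `-i z` is the imaginary part of `G` at `z`.
    have h2 := hre (-Complex.I • z)
    have h1 := (Complex.continuous_ofReal.tendsto _).comp (hre z)
    have h3 := ((Complex.continuous_ofReal.tendsto _).comp h2).mul_const Complex.I
    have h4 := h1.add h3
    simp only [Complex.ofReal_zero, zero_mul, add_zero] at h4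
    refine h4.congr fun j => ?_
    simp only [Function.comp, map_smul, smul_eq_mul]
    apply Complex.ext <;> simp
  have hzero : ∀ μ : ℂ, 1 ≤ ‖μ‖ → ∀ k : ℕ, ∀ z,
      ((complexify M - algebraMap ℂ _ μ) ^ k) z = 0 → G z = 0 := by
    intro μ hμ k
    induction k with
    | zero =>
      intro z hz
      rw [show z = 0 from hz, map_zero]
    | succ k ih =>
      intro z hz
      have hpow : ∀ n : ℕ, G ((complexify M ^ n) z) = μ ^ n * G z := by
        intro n
        induction n with
        | zero => simp
        | succ n ihn =>
          have hz' : complexify M z = μ • z + (complexify M - algebraMap ℂ _ μ) z := by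
            simp [LinearMap.sub_apply, Module.algebraMap_end_apply]
          have hw : G ((complexify M ^ n) ((complexify M - algebraMap ℂ _ μ) z)) = 0 := by
            refine ih _ ?_
            have hc : Commute ((complexify M - algebraMap ℂ _ μ) ^ k) (complexify M ^ n) :=
              (((Commute.refl (complexify M)).sub_left (Algebra.commutes μ _)).pow_pow k n)
            rw [← Module.End.mul_apply, ← Module.End.mul_apply, mul_assoc, ← mul_assoc, hc.eq,
              mul_assoc, ← pow_succ, Module.End.mul_apply, hz, map_zero]
          rw [pow_succ, Module.End.mul_apply, hz', map_add, map_add, hw, map_smul, map_smul, ihn,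
            smul_eq_mul]
          ring
      have hle : ∀ j : ℕ, ‖G z‖ ≤ ‖G ((complexify M ^ (N * j)) z)‖ := by
        intro j
        rw [hpow, norm_mul, norm_pow]
        exact le_mul_of_one_le_left (norm_nonneg _) (one_le_pow₀ hμ)
      have := ge_of_tendsto' (hGt z).norm hle
      rw [norm_zero] at this
      exact norm_le_zero_iff.mp this
  have hle : spectralSubspace M {μ | 1 ≤ ‖μ‖} ≤ LinearMap.ker (f : E d →ₗ[ℝ] ℝ) := by
    rw [spectralSubspace_le_iff]
    intro μ hμ z hz
    rw [mem_maxGen_iff] at hz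
    obtain ⟨k, hk⟩ := hz
    rw [LinearMap.mem_ker, ContinuousLinearMap.coe_coe, hG, hzero μ hμ k z hk, Complex.zero_re]
  exact hle hx

/-- A convex set that is absorbed into itself with a gain by a power of `M` contains the
center-unstable subspace of `M`. -/
theorem spectralSubspace_subset_interior (M : E d →L[ℝ] E d) (N : ℕ) {S V : Set (E d)}
    (hS : Convex ℝ S) (h0 : 0 ∈ S) (hV : V ∈ 𝓝 (0 : E d))
    (hrec : ∀ a ∈ S, ∀ v ∈ V, (M ^ N) a + v ∈ S) :
    (spectralSubspace M {μ | 1 ≤ ‖μ‖} : Set (E d)) ⊆ interior S := by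
  intro x hx
  by_contra hxS
  have hVS : V ⊆ S := fun v hv => by simpa using hrec 0 h0 v hv
  have h0S : (0 : E d) ∈ interior S := mem_interior_iff_mem_nhds.2 (Filter.mem_of_superset hV hVS)
  obtain ⟨f, hf⟩ := geometric_hahn_banach_open_point hS.interior isOpen_interior hxS
  -- A convex set with nonempty interior lies in the closure of its interior.
  have hfS : ∀ a ∈ S, f a ≤ f x := by
    intro a ha
    have hcl : a ∈ closure (interior S) := by
      rw [hS.closure_interior_eq_closure_of_nonempty_interior ⟨0, h0S⟩]
      exact subset_closure ha
    exact closure_minimal (fun y hy => (hf y hy).le) (isClosed_Iic.preimage f.continuous) hcl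
  have hsum : ∀ n : ℕ, ∀ v : ℕ → E d, (∀ j, v j ∈ V) →
      ∑ j ∈ Finset.range n, (M ^ (N * j)) (v j) ∈ S := by
    intro n
    induction n with
    | zero => intro v _; simpa using h0
    | succ n ih =>
      intro v hv
      have := hrec _ (ih (fun j => v (j + 1)) fun j => hv _) _ (hv 0)
      rw [map_sum] at this
      rw [Finset.sum_range_succ']
      simpa [mul_add, pow_add, (Commute.refl M).pow_pow _ _ |>.eq] using this
  have ht : ∀ y, Filter.Tendsto (fun j : ℕ => f ((M ^ (N * j)) y)) Filter.atTop (𝓝 0) := by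
    intro y
    obtain ⟨δ, hδ, hy1, hy2⟩ : ∃ δ : ℝ, 0 < δ ∧ δ • y ∈ V ∧ -(δ • y) ∈ V := by
      have hc1 : Filter.Tendsto (fun δ : ℝ => δ • y) (𝓝[>] 0) (𝓝 0) := by
        have : Continuous fun δ : ℝ => δ • y := by fun_prop
        simpa using (this.tendsto 0).mono_left nhdsWithin_le_nhds
      have hc2 : Filter.Tendsto (fun δ : ℝ => -(δ • y)) (𝓝[>] 0) (𝓝 0) := by simpa using hc1.neg
      obtain ⟨δ, h⟩ := ((hc1.eventually hV).and ((hc2.eventually hV).and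
        (eventually_mem_nhdsWithin : ∀ᶠ δ in 𝓝[>] (0 : ℝ), δ ∈ Ioi 0))).exists
      exact ⟨δ, h.2.2, h.1, h.2.1⟩
    have hs : Summable fun j : ℕ => |f ((M ^ (N * j)) y)| := by
      refine summable_of_sum_range_le (c := f x / δ) (fun _ => abs_nonneg _) fun n => ?_
      -- The signs are chosen so that each term of the sum contributes `δ |f (M^(Nj) y)|`.
      have h1 := hfS _ (hsum n (fun j => if 0 ≤ f ((M ^ (N * j)) y) then δ • y else -(δ • y))
        fun j => by split_ifs <;> assumption)
      rw [le_div_iff₀ hδ, Finset.sum_mul]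
      refine le_of_eq_of_le ?_ h1
      rw [map_sum]
      refine Finset.sum_congr rfl fun j _ => ?_
      split_ifs with h
      · rw [abs_of_nonneg h, map_smul, map_smul, smul_eq_mul, mul_comm]
      · rw [abs_of_neg (not_le.mp h), map_neg, map_neg, map_smul, map_smul, smul_eq_mul]
        ring
    exact (tendsto_zero_iff_abs_tendsto_zero _).2 hs.tendsto_atTop_zero
  have := hf 0 h0S
  rw [functional_eq_zero_of_tendsto M f N ht hx, map_zero] at this
  exact lt_irrefl _ this

/-- Write `x + f = (1 - s) ((1 - s)⁻¹ x) + s (s⁻¹ f)`. For small `s > 0` the first point is still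
interior and the second lies in `F`. -/
theorem add_mem_interior_of_submodule {S : Set (E d)} (hS : Convex ℝ S) {F : Submodule ℝ (E d)}
    (hF : (F : Set (E d)) ⊆ S) {x f : E d} (hx : x ∈ interior S) (hf : f ∈ F) :
    x + f ∈ interior S := by
  have hc : Filter.Tendsto (fun s : ℝ => (1 - s)⁻¹ • x) (𝓝[>] 0) (𝓝 x) := by
    have : ContinuousAt (fun s : ℝ => (1 - s)⁻¹ • x) 0 := by
      refine ContinuousAt.smul (f := fun s : ℝ => (1 - s)⁻¹) ?_ continuousAt_const
      exact ContinuousAt.inv₀ (f := fun s : ℝ => 1 - s) (by fun_prop) (by norm_num)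
    simpa using this.tendsto.mono_left nhdsWithin_le_nhds
  have h1 : ∀ᶠ s : ℝ in 𝓝[>] 0, (1 - s)⁻¹ • x ∈ interior S := hc (isOpen_interior.mem_nhds hx)
  obtain ⟨s, hs, hs0, hs1⟩ := (h1.and (Ioo_mem_nhdsGT (zero_lt_one' ℝ))).exists
  have := hS.combo_interior_self_mem_interior hs (hF (F.smul_mem s⁻¹ hf)) (sub_pos.2 hs1) hs0.le
    (by ring)
  rwa [smul_smul, smul_smul, mul_inv_cancel₀ (sub_pos.2 hs1).ne', mul_inv_cancel₀ hs0.ne', one_smul,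
    one_smul] at this

/-- Expanding `r j` in the standard basis reduces the bound to the finitely many summable sequences
`‖M^j (p e_i)‖`. The constant depends neither on `n` nor on `r`. -/
theorem exists_bound_sum_pow (M : E d →L[ℝ] E d) (p : E d →L[ℝ] E d)
    (hp : ∀ x, p x ∈ spectralSubspace M {μ | ‖μ‖ < 1}) :
    ∃ C : ℝ, 0 ≤ C ∧ ∀ (n : ℕ) (r : ℕ → E d) (ρ : ℝ), (∀ j, ‖r j‖ ≤ ρ) →
      ‖∑ j ∈ Finset.range n, (M ^ j) (p (r j))‖ ≤ C * ρ := by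
  have hs := fun i : Fin d => summable_norm_pow M (hp (EuclideanSpace.single i 1))
  refine ⟨∑ i, ∑' j, ‖(M ^ j) (p (EuclideanSpace.single i 1))‖,
    Finset.sum_nonneg fun i _ => tsum_nonneg fun _ => norm_nonneg _, fun n r ρ hr => ?_⟩
  have hρ : 0 ≤ ρ := (norm_nonneg _).trans (hr 0)
  have h1 : ∀ j, ‖(M ^ j) (p (r j))‖ ≤ ∑ i, ‖(M ^ j) (p (EuclideanSpace.single i 1))‖ * ρ := by
    intro j
    have hexp : r j = ∑ i, r j i • EuclideanSpace.single i (1 : ℝ) := by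
      conv_lhs => rw [← (EuclideanSpace.basisFun (Fin d) ℝ).sum_repr (r j)]
      simp
    conv_lhs => rw [hexp]
    rw [map_sum, map_sum]
    refine norm_sum_le_of_le _ fun i _ => ?_
    rw [map_smul, map_smul, norm_smul, mul_comm]
    exact mul_le_mul_of_nonneg_left ((PiLp.norm_apply_le _ i).trans (hr j)) (norm_nonneg _)
  refine (norm_sum_le_of_le _ fun j _ => h1 j).trans ?_
  rw [Finset.sum_comm, Finset.sum_mul]
  refine Finset.sum_le_sum fun i _ => ?_
  rw [← Finset.sum_mul]
  exact mul_le_mul_of_nonneg_right ((hs i).sum_le_tsum _ fun _ _ => norm_nonneg _) hρ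

end Dynamics

/-! ### Carathéodory solutions: superposition, shift, concatenation, time reversal. -/

section Solutions

theorem exists_norm_ae_bound {V : Type*} [NormedAddCommGroup V] {f : ℝ → V}
    (hf : MemLp f ⊤ volume) : ∃ M : ℝ, 0 ≤ M ∧ ∀ᵐ t, ‖f t‖ ≤ M := by
  have hfin : eLpNormEssSup f volume ≠ ⊤ := by
    rw [← eLpNorm_exponent_top]
    exact hf.2.ne
  refine ⟨(eLpNormEssSup f volume).toReal, ENNReal.toReal_nonneg, ?_⟩
  filter_upwards [ae_le_eLpNormEssSup (f := f) (μ := volume)] with t ht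
  simpa using ENNReal.toReal_mono hfin ht

theorem ae_comp_add {p : ℝ → Prop} (h : ∀ᵐ t, p t) (c : ℝ) : ∀ᵐ t, p (t + c) :=
  (measurePreserving_add_right volume c).quasiMeasurePreserving.ae h

theorem ae_comp_neg {p : ℝ → Prop} (h : ∀ᵐ t, p t) : ∀ᵐ t, p (-t) :=
  (Measure.measurePreserving_neg (volume : Measure ℝ)).quasiMeasurePreserving.ae h

theorem memLp_comp_add {V : Type*} [NormedAddCommGroup V] {f : ℝ → V} (hf : MemLp f ⊤ volume)
    (c : ℝ) : MemLp (fun t => f (t + c)) ⊤ volume :=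
  hf.comp_measurePreserving (measurePreserving_add_right volume c)

theorem memLp_comp_neg {V : Type*} [NormedAddCommGroup V] {f : ℝ → V} (hf : MemLp f ⊤ volume) :
    MemLp (fun t => f (-t)) ⊤ volume :=
  hf.comp_measurePreserving (Measure.measurePreserving_neg (volume : Measure ℝ))

theorem IsPeriodicLinfty.int_mul {V : Type*} [NormedAddCommGroup V] {T : ℝ} {f : ℝ → V}
    (hf : IsPeriodicLinfty T f) (n : ℤ) : ∀ᵐ t, f (t + n * T) = f t := by
  have hnat : ∀ n : ℕ, ∀ᵐ t, f (t + n * T) = f t := by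
    intro n
    induction n with
    | zero => simp
    | succ n ih =>
      filter_upwards [ih, ae_comp_add hf.2 (n * T)] with t h1 h2
      rw [← h1, ← h2]
      congr 1
      push_cast
      ring
  obtain ⟨k, rfl | rfl⟩ := n.eq_nat_or_neg
  · exact_mod_cast hnat k
  · filter_upwards [ae_comp_add (hnat k) (-(k * T))] with t ht
    rw [neg_add_cancel_right] at ht
    rw [ht]
    push_cast
    congr 1
    ring

variable {d m : ℕ} {A : ℝ → E d →L[ℝ] E d} {B : ℝ → E m →L[ℝ] E d}

theorem aestronglyMeasurable_apply {k : ℕ} {F : ℝ → E k →L[ℝ] E d} {g : ℝ → E k}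
    (hF : AEStronglyMeasurable F volume) (hg : AEStronglyMeasurable g volume) :
    AEStronglyMeasurable (fun t => F t (g t)) volume :=
  isBoundedBilinearMap_apply.continuous.comp_aestronglyMeasurable (hF.prodMk hg)

theorem memLp_apply {u : ℝ → E m} (hB : MemLp B ⊤ volume) (hu : MemLp u ⊤ volume) :
    MemLp (fun t => B t (u t)) ⊤ volume := by
  obtain ⟨M, hM, hb⟩ := exists_norm_ae_bound hB
  obtain ⟨K, hK, hk⟩ := exists_norm_ae_bound hu
  refine memLp_top_of_bound (aestronglyMeasurable_apply hB.1 hu.1) (M * K) ?_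
  filter_upwards [hb, hk] with t h1 h2
  exact (B t).le_of_opNorm_le_of_le h1 h2

theorem intervalIntegrable_apply (hA : MemLp A ⊤ volume) {ξ : ℝ → E d} (hξ : Continuous ξ)
    (s t : ℝ) : IntervalIntegrable (fun r => A r (ξ r)) volume s t := by
  obtain ⟨M, hM, hb⟩ := exists_norm_ae_bound hA
  have hi : IntervalIntegrable (fun r => M * ‖ξ r‖) volume s t :=
    (continuous_const.mul hξ.norm).intervalIntegrable s t
  refine hi.mono_fun' (aestronglyMeasurable_apply hA.1 hξ.aestronglyMeasurable).restrict ?_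
  refine ae_restrict_of_ae ?_
  filter_upwards [hb] with r hr
  exact (A r).le_of_opNorm_le hr _

theorem intervalIntegrable_input {u : ℝ → E m} (hB : MemLp B ⊤ volume) (hu : MemLp u ⊤ volume)
    (s t : ℝ) : IntervalIntegrable (fun r => B r (u r)) volume s t := by
  have h := memLp_apply hB hu
  obtain ⟨M, hM, hb⟩ := exists_norm_ae_bound h
  refine (intervalIntegrable_const (c := M)).mono_fun' h.1.restrict (ae_restrict_of_ae ?_)
  filter_upwards [hb] with r hr using hr

theorem intervalIntegrable_rhs (hA : MemLp A ⊤ volume) (hB : MemLp B ⊤ volume) {u : ℝ → E m}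
    (hu : MemLp u ⊤ volume) {ξ : ℝ → E d} (hξ : Continuous ξ) (s t : ℝ) :
    IntervalIntegrable (fun r => A r (ξ r) + B r (u r)) volume s t :=
  (intervalIntegrable_apply hA hξ s t).add (intervalIntegrable_input hB hu s t)

theorem IsSolution.of_base (hA : MemLp A ⊤ volume) (hB : MemLp B ⊤ volume) {u : ℝ → E m}
    (hu : MemLp u ⊤ volume) {ξ : ℝ → E d} (hξ : Continuous ξ) (c : ℝ)
    (h : ∀ t, ξ t - ξ c = ∫ r in c..t, (A r (ξ r) + B r (u r))) : IsSolution A B u ξ := by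
  refine ⟨hξ, fun s t => ?_⟩
  rw [← intervalIntegral.integral_interval_sub_left (intervalIntegrable_rhs hA hB hu hξ c t)
    (intervalIntegrable_rhs hA hB hu hξ c s), ← h, ← h]
  abel

theorem IsSolution.add (hA : MemLp A ⊤ volume) (hB : MemLp B ⊤ volume) {u v : ℝ → E m}
    (hu : MemLp u ⊤ volume) (hv : MemLp v ⊤ volume) {ξ η : ℝ → E d} (h1 : IsSolution A B u ξ)
    (h2 : IsSolution A B v η) :
    IsSolution A B (fun t => u t + v t) (fun t => ξ t + η t) := by
  refine ⟨h1.1.add h2.1, fun s t => ?_⟩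
  rw [add_sub_add_comm, h1.2, h2.2, ← intervalIntegral.integral_add
    (intervalIntegrable_rhs hA hB hu h1.1 s t) (intervalIntegrable_rhs hA hB hv h2.1 s t)]
  refine intervalIntegral.integral_congr fun r _ => ?_
  simp only [map_add]
  abel

theorem IsSolution.smul {u : ℝ → E m} {ξ : ℝ → E d} (h : IsSolution A B u ξ) (c : ℝ) :
    IsSolution A B (fun t => c • u t) (fun t => c • ξ t) := by
  refine ⟨h.1.const_smul c, fun s t => ?_⟩
  rw [← smul_sub, h.2, ← intervalIntegral.integral_smul]
  refine intervalIntegral.integral_congr fun r _ => ?_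
  simp only [map_smul, smul_add]

theorem isSolution_zero : IsSolution A B (fun _ => 0) (fun _ => 0) :=
  ⟨continuous_const, fun s t => by simp⟩

theorem memLp_zero : MemLp (fun _ : ℝ => (0 : E m)) ⊤ volume := MemLp.zero'

theorem IsSolution.sum (hA : MemLp A ⊤ volume) (hB : MemLp B ⊤ volume) {ι : Type*}
    (F : Finset ι) {u : ι → ℝ → E m} {ξ : ι → ℝ → E d} (hu : ∀ i, MemLp (u i) ⊤ volume)
    (h : ∀ i, IsSolution A B (u i) (ξ i)) :
    IsSolution A B (fun t => ∑ i ∈ F, u i t) (fun t => ∑ i ∈ F, ξ i t) := by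
  classical
  induction F using Finset.induction_on with
  | empty => simpa using isSolution_zero
  | insert i F hi ih =>
    simp only [Finset.sum_insert hi]
    exact (h i).add hA hB (hu i) (memLp_finsetSum F fun j _ => hu j) ih

theorem IsSolution.shift {u : ℝ → E m} {ξ : ℝ → E d} (h : IsSolution A B u ξ) {c : ℝ}
    (hA : ∀ᵐ t, A (t + c) = A t) (hB : ∀ᵐ t, B (t + c) = B t) :
    IsSolution A B (fun t => u (t + c)) (fun t => ξ (t + c)) := by
  refine ⟨h.1.comp (continuous_add_const c), fun s t => ?_⟩
  rw [h.2, ← intervalIntegral.integral_comp_add_right]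
  refine intervalIntegral.integral_congr_ae ?_
  filter_upwards [hA, hB] with r h1 h2 _
  rw [h1, h2]

theorem IsSolution.concat (hA : MemLp A ⊤ volume) (hB : MemLp B ⊤ volume) {u v : ℝ → E m}
    (hu : MemLp u ⊤ volume) (hv : MemLp v ⊤ volume) {ξ η : ℝ → E d} (h1 : IsSolution A B u ξ)
    (h2 : IsSolution A B v η) {c : ℝ} (hc : ξ c = η c) :
    MemLp ((Iic c).piecewise u v) ⊤ volume ∧
      IsSolution A B ((Iic c).piecewise u v) (fun t => if t ≤ c then ξ t else η t) := by
  classical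
  have hm : MemLp ((Iic c).piecewise u v) ⊤ volume :=
    MemLp.piecewise measurableSet_Iic (hu.restrict _) (hv.restrict _)
  refine ⟨hm, ?_⟩
  have hcont : Continuous fun t => if t ≤ c then ξ t else η t :=
    Continuous.if_le h1.1 h2.1 continuous_id continuous_const fun t ht => by
      rw [show t = c from ht, hc]
  refine IsSolution.of_base hA hB hm hcont c fun t => ?_
  rw [if_pos le_rfl]
  rcases le_or_gt t c with htc | htc
  · rw [if_pos htc, h1.2]
    refine intervalIntegral.integral_congr_ae (Filter.Eventually.of_forall fun r hr => ?_)
    rw [uIoc_of_ge htc] at hr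
    rw [if_pos hr.2, piecewise_eq_of_mem _ _ _ (show r ∈ Iic c from hr.2)]
  · rw [if_neg htc.not_ge, hc, h2.2]
    refine intervalIntegral.integral_congr_ae (Filter.Eventually.of_forall fun r hr => ?_)
    rw [uIoc_of_le htc.le] at hr
    rw [if_neg hr.1.not_ge, piecewise_eq_of_notMem _ _ _ (show r ∉ Iic c from hr.1.not_ge)]

/-- Time reversal of the coefficients. -/
def timeRev {V : Type*} [Neg V] (f : ℝ → V) : ℝ → V := fun t => -f (-t)

@[simp] theorem timeRev_timeRev {V : Type*} [InvolutiveNeg V] (f : ℝ → V) :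
    timeRev (timeRev f) = f := by
  ext t
  simp [timeRev]

theorem memLp_timeRev {V : Type*} [NormedAddCommGroup V] {f : ℝ → V} (hf : MemLp f ⊤ volume) :
    MemLp (timeRev f) ⊤ volume :=
  (memLp_comp_neg hf).neg

theorem IsPeriodicLinfty.timeRev {V : Type*} [NormedAddCommGroup V] {T : ℝ} {f : ℝ → V}
    (hf : IsPeriodicLinfty T f) : IsPeriodicLinfty T (timeRev f) := by
  refine ⟨memLp_timeRev hf.1, ?_⟩
  filter_upwards [ae_comp_neg (ae_comp_add hf.2 (-T))] with t ht
  rw [neg_add_cancel_right] at ht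
  simp only [PeriodicLinear.timeRev]
  rw [ht, neg_add]

theorem IsSolution.timeRev {u : ℝ → E m} {ξ : ℝ → E d} (h : IsSolution A B u ξ) :
    IsSolution (timeRev A) (timeRev B) (fun t => u (-t)) (fun t => ξ (-t)) := by
  refine ⟨h.1.comp continuous_neg, fun s t => ?_⟩
  rw [h.2, intervalIntegral.integral_symm, ← intervalIntegral.integral_comp_neg,
    ← intervalIntegral.integral_neg]
  refine intervalIntegral.integral_congr fun r _ => ?_
  simp only [PeriodicLinear.timeRev, neg_add, neg_apply]

/-- `ξ` need not be differentiable everywhere, so Gronwall is applied to the integral of `M ‖ξ‖ +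
c`, which dominates `‖ξ‖` and is differentiable because `ξ` is continuous. -/
theorem IsSolution.norm_le {u : ℝ → E m} {ξ : ℝ → E d} (h : IsSolution A B u ξ) {M c : ℝ}
    (hAM : ∀ᵐ t, ‖A t‖ ≤ M) (hBu : ∀ᵐ t, ‖B t (u t)‖ ≤ c) {a t : ℝ} (ha : ξ a = 0)
    (hat : a ≤ t) : ‖ξ t‖ ≤ gronwallBound 0 M c (t - a) := by
  have hgc : Continuous fun r => M * ‖ξ r‖ + c := (continuous_const.mul h.1.norm).add_const c
  have hle : ∀ t, a ≤ t → ‖ξ t‖ ≤ ∫ r in a..t, (M * ‖ξ r‖ + c) := by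
    intro t ht
    have := h.2 a t
    rw [ha, sub_zero] at this
    rw [this]
    refine intervalIntegral.norm_integral_le_of_norm_le ht ?_ (hgc.intervalIntegrable _ _)
    filter_upwards [hAM, hBu] with r h1 h2 _
    exact (norm_add_le _ _).trans (add_le_add ((A r).le_of_opNorm_le h1 _) h2)
  obtain ⟨M', hM'⟩ := hAM.exists
  have hM : 0 ≤ M := (norm_nonneg _).trans hM'
  obtain ⟨c', hc'⟩ := hBu.exists
  have hc : 0 ≤ c := (norm_nonneg _).trans hc'
  have hd : ∀ x, HasDerivAt (fun t => ∫ r in a..t, (M * ‖ξ r‖ + c)) (M * ‖ξ x‖ + c) x :=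
    fun x => hgc.integral_hasStrictDerivAt a x |>.hasDerivAt
  refine (hle t hat).trans ((le_abs_self _).trans ?_)
  refine norm_le_gronwallBound_of_norm_deriv_right_le (a := a) (b := t)
    (f' := fun x => M * ‖ξ x‖ + c)
    (fun x _ => (hd x).continuousAt.continuousWithinAt) (fun x _ => (hd x).hasDerivWithinAt)
    (by simp) (fun x hx => ?_) t ⟨hat, le_rfl⟩
  rw [Real.norm_of_nonneg (by positivity)]
  gcongr
  exact (hle x hx.1).trans (le_abs_self _)

theorem IsSolution.eq_zero (hA : MemLp A ⊤ volume) {ξ : ℝ → E d}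
    (h : IsSolution A B (fun _ => 0) ξ) {a : ℝ} (ha : ξ a = 0) (t : ℝ) : ξ t = 0 := by
  rcases le_total a t with hat | hat
  · obtain ⟨M, hM, hb⟩ := exists_norm_ae_bound hA
    have := h.norm_le hb (c := 0) (by simp) ha hat
    rw [gronwallBound_ε0_δ0] at this
    exact norm_le_zero_iff.mp this
  · obtain ⟨M, hM, hb⟩ := exists_norm_ae_bound (memLp_timeRev hA)
    have := h.timeRev.norm_le hb (c := 0) (by simp) (a := -a) (t := -t) (by simpa using ha)
      (neg_le_neg hat)
    rw [gronwallBound_ε0_δ0] at this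
    simpa using norm_le_zero_iff.mp this

/-! ### The principal fundamental solution: cocycle law, continuity, periodicity. -/

theorem fundamental_self (hA : MemLp A ⊤ volume) (s : ℝ) :
    fundamental A s s = ContinuousLinearMap.id ℝ (E d) := by
  simpa using (fundamental_spec hA s).2 s

theorem continuous_fundamental (hA : MemLp A ⊤ volume) (s : ℝ) :
    Continuous fun t => fundamental A t s :=
  (fundamental_spec hA s).1

theorem isSolution_fundamental (hA : MemLp A ⊤ volume) (B : ℝ → E m →L[ℝ] E d) (s : ℝ) (x : E d) :
    IsSolution A B (fun _ => 0) (fun t => fundamental A t s x) := by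
  have hc := continuous_fundamental hA s
  refine ⟨hc.clm_apply continuous_const, fun a b => ?_⟩
  have hi := fun t => intervalIntegrable_comp hA hc s t
  have h := fun t => (fundamental_spec hA s).2 t
  have hab : fundamental A b s - fundamental A a s =
      ∫ r in a..b, (A r) ∘L (fundamental A r s) := by
    rw [← intervalIntegral.integral_interval_sub_left (hi b) (hi a), h b, h a]
    abel
  rw [← sub_apply, hab, ContinuousLinearMap.intervalIntegral_apply
    (intervalIntegrable_comp hA hc a b)]
  simp

theorem IsSolution.add_fundamental (hA : MemLp A ⊤ volume) (hB : MemLp B ⊤ volume) {u : ℝ → E m}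
    (hu : MemLp u ⊤ volume) {ξ : ℝ → E d} (h : IsSolution A B u ξ) (s : ℝ) (x : E d) :
    IsSolution A B u (fun t => ξ t + fundamental A t s x) := by
  simpa only [add_zero] using h.add hA hB hu memLp_zero (isSolution_fundamental hA B s x)

theorem IsSolution.sub_fundamental (hA : MemLp A ⊤ volume) (hB : MemLp B ⊤ volume) {u : ℝ → E m}
    (hu : MemLp u ⊤ volume) {ξ : ℝ → E d} (h : IsSolution A B u ξ) (s : ℝ) (x : E d) :
    IsSolution A B u (fun t => ξ t - fundamental A t s x) := by
  simpa only [map_neg, ← sub_eq_add_neg] using h.add_fundamental hA hB hu s (-x)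

theorem memLp_zero_input : MemLp (fun _ : ℝ => (0 : E m →L[ℝ] E d)) ⊤ volume :=
  memLp_top_const 0

theorem IsSolution.eq_fundamental (hA : MemLp A ⊤ volume) {ξ : ℝ → E d}
    (h : IsSolution A B (fun _ => 0) ξ) (s t : ℝ) : ξ t = fundamental A t s (ξ s) := by
  have h' : IsSolution A (fun _ => (0 : E m →L[ℝ] E d)) (fun _ => 0) ξ :=
    ⟨h.1, fun a b => by simpa using h.2 a b⟩
  refine sub_eq_zero.mp ((h'.sub_fundamental hA memLp_zero_input memLp_zero s (ξ s)).eq_zero hA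
    (a := s) ?_ t)
  simp [fundamental_self hA]

theorem fundamental_apply_fundamental (hA : MemLp A ⊤ volume) (t s r : ℝ) (x : E d) :
    fundamental A t s (fundamental A s r x) = fundamental A t r x :=
  ((isSolution_fundamental hA (fun _ => (0 : E 0 →L[ℝ] E d)) r x).eq_fundamental hA s t).symm

theorem fundamental_comp (hA : MemLp A ⊤ volume) (t s r : ℝ) :
    fundamental A t s ∘L fundamental A s r = fundamental A t r :=
  ContinuousLinearMap.ext (fundamental_apply_fundamental hA t s r)

theorem fundamental_injective (hA : MemLp A ⊤ volume) (t s : ℝ) :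
    Function.Injective (fundamental A t s) := by
  refine Function.LeftInverse.injective (g := fundamental A s t) fun x => ?_
  rw [fundamental_apply_fundamental hA, fundamental_self hA]
  rfl

/-- `X(0, s)` is the inverse of `X(s, 0)`, and inversion is continuous at units of a Banach algebra.
-/
theorem continuous_fundamental_right (hA : MemLp A ⊤ volume) (t : ℝ) :
    Continuous fun s => fundamental A t s := by
  have hmul : ∀ a b c, fundamental A a b * fundamental A b c = fundamental A a c :=
    fundamental_comp hA
  have hinv : ∀ s, fundamental A 0 s = Ring.inverse (fundamental A s 0) := by
    intro s
    have h1 : fundamental A s 0 * fundamental A 0 s = 1 := by rw [hmul, fundamental_self hA]; rfl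
    have h2 : fundamental A 0 s * fundamental A s 0 = 1 := by rw [hmul, fundamental_self hA]; rfl
    exact (Ring.inverse_unit ⟨fundamental A s 0, fundamental A 0 s, h1, h2⟩).symm
  have h0 : Continuous fun s => fundamental A 0 s := by
    rw [continuous_iff_continuousAt]
    intro s
    have h1 : fundamental A s 0 * fundamental A 0 s = 1 := by rw [hmul, fundamental_self hA]; rfl
    have h2 : fundamental A 0 s * fundamental A s 0 = 1 := by rw [hmul, fundamental_self hA]; rfl
    rw [show (fun s => fundamental A 0 s) = fun s => Ring.inverse (fundamental A s 0) from
      funext hinv]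
    exact ContinuousAt.comp (f := fun s => fundamental A s 0)
      (NormedRing.inverse_continuousAt ⟨fundamental A s 0, fundamental A 0 s, h1, h2⟩)
      (continuous_fundamental hA 0).continuousAt
  exact (continuous_const.mul h0).congr fun s => hmul t 0 s

theorem fundamental_add_int_mul {T : ℝ} (hA : IsPeriodicLinfty T A) (n : ℤ) (t s : ℝ) :
    fundamental A (t + n * T) (s + n * T) = fundamental A t s := by
  ext1 x
  have h := (isSolution_fundamental hA.1 (fun _ => (0 : E 0 →L[ℝ] E d)) (s + n * T) x).shift
    (hA.int_mul n) (Filter.Eventually.of_forall fun _ => rfl)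
  have := h.eq_fundamental hA.1 s t
  simpa [fundamental_self hA.1] using this

theorem fundamental_timeRev (hA : MemLp A ⊤ volume) (t s : ℝ) :
    fundamental (timeRev A) t s = fundamental A (-t) (-s) := by
  ext1 x
  have h := (isSolution_fundamental hA (fun _ => (0 : E 0 →L[ℝ] E d)) (-s) x).timeRev
  have := h.eq_fundamental (memLp_timeRev hA) s t
  simpa [fundamental_self hA] using this.symm

end Solutions

/-! ### Reachable sets from the origin. -/

section Reach

variable {d m : ℕ} {A : ℝ → E d →L[ℝ] E d} {B : ℝ → E m →L[ℝ] E d} {U : Set (E m)} {T : ℝ}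

theorem zero_mem_controls (h0 : (0 : E m) ∈ U) : (fun _ => 0) ∈ controls U :=
  ⟨memLp_zero, Filter.Eventually.of_forall fun _ => h0⟩

theorem piecewise_mem_controls {u v : ℝ → E m} (hu : u ∈ controls U) (hv : v ∈ controls U)
    (c : ℝ) : (∀ᵐ t, (Iic c).piecewise u v t ∈ U) := by
  classical
  filter_upwards [hu.2, hv.2] with t h1 h2
  by_cases h : t ∈ Iic c
  · rwa [piecewise_eq_of_mem _ _ _ h]
  · rwa [piecewise_eq_of_notMem _ _ _ h]

theorem zero_mem_reachAt (h0 : (0 : E m) ∈ U) {s t : ℝ} (hst : s ≤ t) :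
    (0 : E d) ∈ reachAt A B U t s 0 :=
  ⟨hst, _, zero_mem_controls h0, _, isSolution_zero, rfl, rfl⟩

/-- Use the first control up to time `s` and the second one afterwards; by superposition the state
`y` at time `s` only adds its free evolution. -/
theorem reachAt_concat (hA : MemLp A ⊤ volume) (hB : MemLp B ⊤ volume) {r s t : ℝ} {y z : E d}
    (hy : y ∈ reachAt A B U s r 0) (hz : z ∈ reachAt A B U t s 0) :
    fundamental A t s y + z ∈ reachAt A B U t r 0 := by
  obtain ⟨hrs, u, hu, ξ, hξ, hξr, hξs⟩ := hy
  obtain ⟨hst, v, hv, η, hη, hηs, hηt⟩ := hz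
  obtain ⟨h1, h2⟩ := hξ.concat hA hB hu.1 hv.1 (hη.add_fundamental hA hB hv.1 s y) (c := s)
    (by simp [hξs, hηs, fundamental_self hA])
  refine ⟨hrs.trans hst, _, ⟨h1, piecewise_mem_controls hu hv s⟩, _, h2, ?_, ?_⟩
  · rw [if_pos hrs, hξr]
  · rcases hst.eq_or_lt with rfl | hlt
    · simp [hξs, fundamental_self hA, ← hηt, hηs]
    · rw [if_neg hlt.not_ge, hηt, add_comm]

theorem reachAt_split (hA : MemLp A ⊤ volume) (hB : MemLp B ⊤ volume) {r s t : ℝ} {y : E d}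
    (hy : y ∈ reachAt A B U t r 0) (hrs : r ≤ s) (hst : s ≤ t) :
    ∃ a ∈ reachAt A B U s r 0, ∃ b ∈ reachAt A B U t s 0, y = fundamental A t s a + b := by
  obtain ⟨-, u, hu, ξ, hξ, hξr, hξt⟩ := hy
  refine ⟨ξ s, ⟨hrs, u, hu, ξ, hξ, hξr, rfl⟩, _,
    ⟨hst, u, hu, _, hξ.sub_fundamental hA hB hu.1 s (ξ s), ?_, rfl⟩, ?_⟩
  · simp [fundamental_self hA]
  · rw [hξt]
    abel

theorem fundamental_mem_reachAt (hA : MemLp A ⊤ volume) (hB : MemLp B ⊤ volume)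
    (h0 : (0 : E m) ∈ U) {r s t : ℝ} (hst : s ≤ t) {y : E d} (hy : y ∈ reachAt A B U s r 0) :
    fundamental A t s y ∈ reachAt A B U t r 0 := by
  simpa using reachAt_concat hA hB hy (zero_mem_reachAt h0 hst)

/-- An earlier start can be spent waiting at the equilibrium 0. -/
theorem reachAt_anti_start (hA : MemLp A ⊤ volume) (hB : MemLp B ⊤ volume) (h0 : (0 : E m) ∈ U)
    {r s t : ℝ} (hrs : r ≤ s) : reachAt A B U t s 0 ⊆ reachAt A B U t r 0 := fun y hy => by
  simpa using reachAt_concat hA hB (zero_mem_reachAt h0 hrs) hy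

theorem reachAt_shift (hA : IsPeriodicLinfty T A) (hB : IsPeriodicLinfty T B) (n : ℤ) {s t : ℝ}
    {x y : E d} (hy : y ∈ reachAt A B U t s x) :
    y ∈ reachAt A B U (t + n * T) (s + n * T) x := by
  obtain ⟨hst, u, hu, ξ, hξ, hξs, hξt⟩ := hy
  have hc : ((-n : ℤ) : ℝ) * T = -(n * T) := by push_cast; ring
  have h := hξ.shift (hA.int_mul (-n)) (hB.int_mul (-n))
  refine ⟨by linarith, _, ⟨memLp_comp_add hu.1 _, ae_comp_add hu.2 _⟩, _, h, ?_, ?_⟩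
  · rw [hc, add_neg_cancel_right, hξs]
  · rw [hc, add_neg_cancel_right, hξt]

theorem convex_reachAt (hA : MemLp A ⊤ volume) (hB : MemLp B ⊤ volume) (hU : Convex ℝ U)
    (t s : ℝ) : Convex ℝ (reachAt A B U t s 0) := by
  rintro x ⟨hst, u, hu, ξ, hξ, hξs, hξt⟩ y ⟨-, v, hv, η, hη, hηs, hηt⟩ a b ha hb hab
  refine ⟨hst, _, ⟨(hu.1.const_smul a).add (hv.1.const_smul b), ?_⟩, _,
    (hξ.smul a).add hA hB (hu.1.const_smul a) (hv.1.const_smul b) (hη.smul b), ?_, ?_⟩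
  · filter_upwards [hu.2, hv.2] with r h1 h2
    exact hU h1 h2 ha hb hab
  · simp [hξs, hηs]
  · simp [hξt, hηt]

theorem exists_bound_reachAt (hA : MemLp A ⊤ volume) (hB : MemLp B ⊤ volume)
    (hU : Bornology.IsBounded U) (t s : ℝ) :
    ∃ ρ : ℝ, ∀ y ∈ reachAt A B U t s 0, ‖y‖ ≤ ρ := by
  obtain ⟨M, hM, hAM⟩ := exists_norm_ae_bound hA
  obtain ⟨K, hK, hBK⟩ := exists_norm_ae_bound hB
  obtain ⟨C, hC⟩ := hU.exists_norm_le
  refine ⟨gronwallBound 0 M (K * C) (t - s), ?_⟩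
  rintro y ⟨hst, u, hu, ξ, hξ, hξs, rfl⟩
  refine hξ.norm_le hAM ?_ hξs hst
  filter_upwards [hBK, hu.2] with r h1 h2
  exact (B r).le_of_opNorm_le_of_le h1 (hC _ h2)

/-- The subspace reachable from `0` within `[s, t]` by unconstrained controls. -/
def reachSubspace (hA : MemLp A ⊤ volume) (hB : MemLp B ⊤ volume) {s t : ℝ} (hst : s ≤ t) :
    Submodule ℝ (E d) where
  carrier := reachAt A B univ t s 0
  zero_mem' := zero_mem_reachAt (mem_univ _) hst
  add_mem' := by
    rintro x y ⟨-, u, hu, ξ, hξ, hξs, hξt⟩ ⟨-, v, hv, η, hη, hηs, hηt⟩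
    exact ⟨hst, _, ⟨hu.1.add hv.1, by simp⟩, _, hξ.add hA hB hu.1 hv.1 hη, by simp [hξs, hηs],
      by simp [hξt, hηt]⟩
  smul_mem' := by
    rintro c x ⟨-, u, hu, ξ, hξ, hξs, hξt⟩
    exact ⟨hst, _, ⟨hu.1.const_smul c, by simp⟩, _, hξ.smul c, by simp [hξs], by simp [hξt]⟩

theorem mem_reachSubspace (hA : MemLp A ⊤ volume) (hB : MemLp B ⊤ volume) {s t : ℝ} (hst : s ≤ t)
    {x : E d} : x ∈ reachSubspace hA hB hst ↔ x ∈ reachAt A B univ t s 0 := Iff.rfl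

theorem fundamental_period_shift (hA : IsPeriodicLinfty T A) (n : ℤ) (j : ℕ) (τ : ℝ) :
    fundamental A (j * T + (n * T + τ)) (n * T + τ) = fundamental A (j * T + τ) τ := by
  rw [← fundamental_add_int_mul hA n (j * T + τ) τ]
  congr 1 <;> ring

/-- Null-controllability from `t₀` is enough to reach everything in finitely many periods. -/
theorem exists_forall_mem_reachAt (hT : 0 < T) (hA : IsPeriodicLinfty T A)
    (hB : IsPeriodicLinfty T B) (t₀ : ℝ)
    (hc : ∀ x, ∃ t > t₀, (0 : E d) ∈ reachAt A B univ t t₀ x) :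
    ∃ n : ℕ, ∀ x : E d, x ∈ reachAt A B univ (n * T + t₀) t₀ 0 := by
  have hle : ∀ k : ℕ, t₀ ≤ k * T + t₀ := fun k => by
    have : 0 ≤ (k : ℝ) * T := by positivity
    linarith
  let L : ℕ →o Submodule ℝ (E d) :=
    { toFun := fun k => reachSubspace hA.1 hB.1 (hle k)
      monotone' := by
        refine monotone_nat_of_le_succ fun k x hx => ?_
        have h1 : t₀ ≤ t₀ + (1 : ℤ) * T := by
          push_cast
          linarith
        have := reachAt_anti_start hA.1 hB.1 (mem_univ _) h1 (reachAt_shift hA hB 1 hx)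
        rw [mem_reachSubspace]
        convert this using 2
        push_cast
        ring }
  -- The subspaces reached in `k` periods increase with `k`, hence become constant from some `n` on.
  obtain ⟨n, hn⟩ := monotone_stabilizes_iff_noetherian.mpr
    (inferInstance : IsNoetherian ℝ (E d)) L
  refine ⟨n, fun x => ?_⟩
  obtain ⟨t, ht, -, u, hu, ξ, hξ, hξ0, hξt⟩ := hc x
  obtain ⟨j, hj⟩ := exists_nat_ge (max (n : ℝ) ((t - t₀) / T))
  have hnj : n ≤ j := by exact_mod_cast (le_max_left _ _).trans hj
  have hjt : t ≤ j * T + t₀ := by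
    have := (div_le_iff₀ hT).1 ((le_max_right _ _).trans hj)
    linarith
  set S : E d →L[ℝ] E d := fundamental A (j * T + t₀) t₀ with hS
  -- Subtracting the free motion from a trajectory that steers `x` to 0 shows that `-X(t, t₀) x` is
  -- reachable from 0. It is then carried on to a full number `j ≥ n` of periods.
  have hx : S (-x) ∈ L n := by
    have h1 : -fundamental A t t₀ x ∈ reachAt A B univ t t₀ 0 :=
      ⟨ht.le, u, hu, _, hξ.sub_fundamental hA.1 hB.1 hu.1 t₀ x,
        by simp [hξ0, fundamental_self hA.1], by simp [hξt]⟩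
    have h2 := fundamental_mem_reachAt hA.1 hB.1 (mem_univ _) hjt h1
    rw [← map_neg, fundamental_apply_fundamental hA.1] at h2
    rw [hn j hnj]
    exact h2
  -- Free flow over `j` periods maps `L n` into `L (j + n) = L n`. Injectivity and equal dimension
  -- give equality, so `S` can be cancelled from `S (-x) ∈ L n`.
  have hmap : (L n).map (S : E d →ₗ[ℝ] E d) = L n := by
    refine Submodule.eq_of_le_of_finrank_eq ?_
      
      (Submodule.equivMapOfInjective (S : E d →ₗ[ℝ] E d) (fundamental_injective hA.1 _ _)
        (L n)).finrank_eq.symm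
    rintro _ ⟨y, hy, rfl⟩
    rw [hn (j + n) (Nat.le_add_left _ _)]
    have h1 : (n : ℝ) * T + t₀ ≤ j * T + (n * T + t₀) := by
      have : 0 ≤ (j : ℝ) * T := by positivity
      linarith
    have := fundamental_mem_reachAt hA.1 hB.1 (mem_univ _) h1 hy
    have hp := fundamental_period_shift hA n j t₀
    rw [Int.cast_natCast] at hp
    rw [hp] at this
    refine (mem_reachSubspace hA.1 hB.1 (hle (j + n))).2 ?_
    have e : ((j + n : ℕ) : ℝ) * T + t₀ = j * T + (n * T + t₀) := by
      push_cast
      ring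
    rw [e]
    exact this
  rw [← hmap] at hx
  obtain ⟨y, hy, hyx⟩ := hx
  have : y = -x := fundamental_injective hA.1 _ _ hyx
  have hmem : x ∈ L n := by
    rw [← neg_neg x, ← this]
    exact neg_mem hy
  exact hmem

/-- If `u i` steers 0 to the `i`-th basis vector, then `∑ x i • u i` steers 0 to `x`, and it takes
values in `U` when `x` is small. -/
theorem reachAt_mem_nhds (hA : MemLp A ⊤ volume) (hB : MemLp B ⊤ volume) (hU : U ∈ 𝓝 (0 : E m))
    {s t : ℝ} (h : ∀ x : E d, x ∈ reachAt A B univ t s 0) :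
    reachAt A B U t s 0 ∈ 𝓝 (0 : E d) := by
  have hst : s ≤ t := (h 0).1
  choose _ u hu ξ hξ hξs hξt using fun i : Fin d => h (EuclideanSpace.single i 1)
  choose K hK hKu using fun i => exists_norm_ae_bound (hu i).1
  obtain ⟨ε, hε, hεU⟩ := Metric.mem_nhds_iff.1 hU
  have hKs : 0 ≤ ∑ i, K i := Finset.sum_nonneg fun i _ => hK i
  -- The summand 1 keeps the denominator positive when all `K i` vanish.
  refine Metric.mem_nhds_iff.2 ⟨ε / (∑ i, K i + 1), by positivity, fun x hx => ?_⟩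
  rw [mem_ball_zero_iff, lt_div_iff₀ (by positivity)] at hx
  refine ⟨hst, _, ⟨memLp_finsetSum Finset.univ fun i _ => (hu i).1.const_smul (x i), ?_⟩, _,
    IsSolution.sum hA hB Finset.univ (fun i => (hu i).1.const_smul (x i))
      (fun i => (hξ i).smul (x i)), ?_, ?_⟩
  · filter_upwards [ae_all_iff.2 hKu] with r hr
    refine hεU (mem_ball_zero_iff.2 (lt_of_le_of_lt ?_ hx))
    have h1 : ‖∑ i, x i • u i r‖ ≤ ∑ i, ‖x‖ * K i := by
      refine norm_sum_le_of_le _ fun i _ => ?_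
      rw [norm_smul]
      exact mul_le_mul (PiLp.norm_apply_le x i) (hr i) (norm_nonneg _) (norm_nonneg _)
    rw [← Finset.mul_sum] at h1
    have := norm_nonneg x
    simp only [Pi.smul_apply]
    linarith
  · simp [hξs]
  · simp only [hξt]
    conv_rhs => rw [← (EuclideanSpace.basisFun (Fin d) ℝ).sum_repr x]
    simp

/-- Negative indices add nothing: a point reached at time `-kT + τ ≥ 0` is also reached at the later
time `τ`, after waiting `k` periods. Integer indices make the periodicity in `τ` evident. -/
theorem mem_reachPeriods_iff (hT : 0 < T) (hA : IsPeriodicLinfty T A) (hB : IsPeriodicLinfty T B)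
    (h0 : (0 : E m) ∈ U) {τ : ℝ} {x : E d} :
    x ∈ reachPeriods T A B U τ ↔ ∃ n : ℤ, x ∈ reachAt A B U (n * T + τ) 0 0 := by
  rw [reachPeriods, mem_iUnion]
  refine ⟨fun ⟨k, hk⟩ => ⟨k, by simpa using hk⟩, fun ⟨n, hn⟩ => ?_⟩
  obtain ⟨k, rfl | rfl⟩ := n.eq_nat_or_neg
  · exact ⟨k, by simpa using hn⟩
  · have h1 : (0 : ℝ) ≤ 0 + (k : ℤ) * T := by
      rw [zero_add]
      positivity
    have := reachAt_anti_start hA.1 hB.1 h0 h1 (reachAt_shift hA hB k hn)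
    refine ⟨0, ?_⟩
    convert this using 2
    push_cast
    ring

theorem reachPeriods_add_int_mul (hT : 0 < T) (hA : IsPeriodicLinfty T A)
    (hB : IsPeriodicLinfty T B) (h0 : (0 : E m) ∈ U) (n : ℤ) (τ : ℝ) :
    reachPeriods T A B U (τ + n * T) = reachPeriods T A B U τ := by
  ext x
  rw [mem_reachPeriods_iff hT hA hB h0, mem_reachPeriods_iff hT hA hB h0]
  constructor
  · rintro ⟨k, hk⟩
    refine ⟨k + n, ?_⟩
    convert hk using 2
    push_cast
    ring
  · rintro ⟨k, hk⟩
    refine ⟨k - n, ?_⟩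
    convert hk using 2
    push_cast
    ring

theorem monotone_reachAt_period (hT : 0 < T) (hA : IsPeriodicLinfty T A)
    (hB : IsPeriodicLinfty T B) (h0 : (0 : E m) ∈ U) (τ : ℝ) :
    Monotone fun k : ℕ => (reachAt A B U (k * T + τ) 0 0 : Set (E d)) := by
  refine monotone_nat_of_le_succ fun k x hx => ?_
  have h1 : (0 : ℝ) ≤ 0 + (1 : ℤ) * T := by
    push_cast
    linarith
  have := reachAt_anti_start hA.1 hB.1 h0 h1 (reachAt_shift hA hB 1 hx)
  convert this using 2
  push_cast
  ring

theorem convex_reachPeriods (hT : 0 < T) (hA : IsPeriodicLinfty T A) (hB : IsPeriodicLinfty T B)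
    (h0 : (0 : E m) ∈ U) (hU : Convex ℝ U) (τ : ℝ) : Convex ℝ (reachPeriods T A B U τ) :=
  Directed.convex_iUnion (monotone_reachAt_period hT hA hB h0 τ).directed_le
    fun _ => convex_reachAt hA.1 hB.1 hU _ _

theorem fundamental_mem_reachPeriods (hA : IsPeriodicLinfty T A) (hB : IsPeriodicLinfty T B)
    (h0 : (0 : E m) ∈ U) {τ τ' : ℝ} (h : τ ≤ τ') {x : E d} (hx : x ∈ reachPeriods T A B U τ) :
    fundamental A τ' τ x ∈ reachPeriods T A B U τ' := by
  rw [reachPeriods, mem_iUnion] at hx ⊢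
  obtain ⟨k, hk⟩ := hx
  refine ⟨k, ?_⟩
  have := fundamental_mem_reachAt hA.1 hB.1 h0 (add_le_add_right h (k * T)) hk
  have hp := fundamental_add_int_mul hA k τ' τ
  rw [Int.cast_natCast, add_comm τ', add_comm τ] at hp
  rwa [hp] at this

/-- This is the recursion that drives the separation argument, with `v` running through a
neighborhood of 0. -/
theorem fundamental_add_mem_reachPeriods (hA : IsPeriodicLinfty T A) (hB : IsPeriodicLinfty T B)
    {τ : ℝ} {n : ℕ} {x v : E d} (hx : x ∈ reachPeriods T A B U τ)
    (hv : v ∈ reachAt A B U (n * T + τ) τ 0) :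
    fundamental A (n * T + τ) τ x + v ∈ reachPeriods T A B U τ := by
  rw [reachPeriods, mem_iUnion] at hx ⊢
  obtain ⟨k, hk⟩ := hx
  refine ⟨n + k, ?_⟩
  have hv' := reachAt_shift hA hB k hv
  have h1 : (n : ℝ) * T + τ + (k : ℤ) * T = n * T + ((k : ℤ) * T + τ) := by ring
  rw [h1, add_comm τ] at hv'
  rw [← Int.cast_natCast k] at hk
  have := reachAt_concat hA.1 hB.1 hk hv'
  rw [fundamental_period_shift hA] at this
  convert this using 2
  push_cast
  ring

theorem zero_mem_reachPeriods (hT : 0 < T) (h0 : (0 : E m) ∈ U) (τ : ℝ) :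
    (0 : E d) ∈ reachPeriods T A B U τ := by
  rw [reachPeriods, mem_iUnion]
  obtain ⟨k, hk⟩ := exists_nat_ge (-τ / T)
  refine ⟨k, zero_mem_reachAt h0 ?_⟩
  have := (div_le_iff₀ hT).1 hk
  linarith

theorem zero_mem_interior_reachPeriods (hT : 0 < T) (hA : IsPeriodicLinfty T A)
    (hB : IsPeriodicLinfty T B) (hU : U ∈ 𝓝 (0 : E m)) {τ : ℝ} {n : ℕ}
    (h : ∀ x : E d, x ∈ reachAt A B univ (n * T + τ) τ 0) :
    (0 : E d) ∈ interior (reachPeriods T A B U τ) := by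
  rw [mem_interior_iff_mem_nhds]
  refine Filter.mem_of_superset (reachAt_mem_nhds hA.1 hB.1 hU h) fun v hv => ?_
  simpa using fundamental_add_mem_reachPeriods hA hB
    (zero_mem_reachPeriods hT (mem_of_mem_nhds hU) τ) hv

end Reach

/-! ### Floquet subspaces as spectral subspaces of the monodromy map. -/

section Floquet

variable {d : ℕ} {A : ℝ → E d →L[ℝ] E d} {T : ℝ}

theorem stable_eq (hT : 0 < T) (hA : MemLp A ⊤ volume) (τ : ℝ) :
    stable T A τ = spectralSubspace (fundamental A (T + τ) τ) {μ | ‖μ‖ < 1} := by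
  refine iSup_floquet_eq (T := T) (fundamental_injective hA _ _) _ _ fun μ hμ => ?_
  rw [mem_Iio, div_lt_iff₀ hT, zero_mul, Real.log_neg_iff (norm_pos_iff.2 hμ), mem_ofPred_eq]

theorem unstable_eq (hT : 0 < T) (hA : MemLp A ⊤ volume) (τ : ℝ) :
    unstable T A τ = spectralSubspace (fundamental A (T + τ) τ) {μ | 1 < ‖μ‖} := by
  refine iSup_floquet_eq (T := T) (fundamental_injective hA _ _) _ _ fun μ hμ => ?_
  rw [mem_Ioi, lt_div_iff₀ hT, zero_mul, Real.log_pos_iff (norm_nonneg _), mem_ofPred_eq]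

theorem centerStable_eq (hT : 0 < T) (hA : MemLp A ⊤ volume) (τ : ℝ) :
    centerStable T A τ = spectralSubspace (fundamental A (T + τ) τ) {μ | ‖μ‖ ≤ 1} := by
  refine iSup_floquet_eq (T := T) (fundamental_injective hA _ _) _ _ fun μ hμ => ?_
  rw [mem_Iic, div_le_iff₀ hT, zero_mul, Real.log_nonpos_iff (norm_nonneg _), mem_ofPred_eq]

theorem centerUnstable_eq (hT : 0 < T) (hA : MemLp A ⊤ volume) (τ : ℝ) :
    centerUnstable T A τ = spectralSubspace (fundamental A (T + τ) τ) {μ | 1 ≤ ‖μ‖} := by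
  refine iSup_floquet_eq (T := T) (fundamental_injective hA _ _) _ _ fun μ hμ => ?_
  rw [mem_Ici, le_div_iff₀ hT, zero_mul, Real.log_nonneg_iff (norm_pos_iff.2 hμ), mem_ofPred_eq]

theorem isCompl_stable_centerUnstable (hT : 0 < T) (hA : MemLp A ⊤ volume) (τ : ℝ) :
    IsCompl (stable T A τ) (centerUnstable T A τ) := by
  rw [stable_eq hT hA, centerUnstable_eq hT hA]
  have : {μ : ℂ | 1 ≤ ‖μ‖} = {μ : ℂ | ‖μ‖ < 1}ᶜ := by
    ext μ
    simp
  rw [this]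
  exact spectralSubspace_isCompl _ fun μ => by simp

/-- By the cocycle law and periodicity, `X(t, s)` intertwines the monodromy maps at `s` and at `t`.
-/
theorem fundamental_mem_spectralSubspace (hA : IsPeriodicLinfty T A) (s t : ℝ) {R : Set ℂ} {x : E d}
    (hx : x ∈ spectralSubspace (fundamental A (T + s) s) R) :
    fundamental A t s x ∈ spectralSubspace (fundamental A (T + t) t) R := by
  refine map_mem_spectralSubspace ?_ hx
  have h := fundamental_add_int_mul hA 1 t s
  rw [Int.cast_one, one_mul, add_comm t, add_comm s] at h
  rw [fundamental_comp hA.1]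
  conv_lhs => rw [← h]
  rw [fundamental_comp hA.1]

theorem fundamental_mem_stable (hT : 0 < T) (hA : IsPeriodicLinfty T A) (s t : ℝ) {x : E d}
    (hx : x ∈ stable T A s) : fundamental A t s x ∈ stable T A t := by
  rw [stable_eq hT hA.1] at hx ⊢
  exact fundamental_mem_spectralSubspace hA s t hx

theorem fundamental_mem_centerUnstable (hT : 0 < T) (hA : IsPeriodicLinfty T A) (s t : ℝ) {x : E d}
    (hx : x ∈ centerUnstable T A s) : fundamental A t s x ∈ centerUnstable T A t := by
  rw [centerUnstable_eq hT hA.1] at hx ⊢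
  exact fundamental_mem_spectralSubspace hA s t hx

theorem monodromy_add_int_mul (hA : IsPeriodicLinfty T A) (n : ℤ) (τ : ℝ) :
    fundamental A (T + (τ + n * T)) (τ + n * T) = fundamental A (T + τ) τ := by
  rw [← add_assoc, fundamental_add_int_mul hA]

theorem stable_add_int_mul (hA : IsPeriodicLinfty T A) (n : ℤ) (τ : ℝ) :
    stable T A (τ + n * T) = stable T A τ := by
  simp only [stable, floquetSpace, monodromy_add_int_mul hA]

theorem centerUnstable_add_int_mul (hA : IsPeriodicLinfty T A) (n : ℤ) (τ : ℝ) :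
    centerUnstable T A (τ + n * T) = centerUnstable T A τ := by
  simp only [centerUnstable, floquetSpace, monodromy_add_int_mul hA]

theorem monodromy_pow (hA : IsPeriodicLinfty T A) (n : ℕ) (τ : ℝ) :
    fundamental A (T + τ) τ ^ n = fundamental A (n * T + τ) τ := by
  induction n with
  | zero =>
    rw [Nat.cast_zero, zero_mul, zero_add, fundamental_self hA.1]
    rfl
  | succ n ih =>
    have h := fundamental_period_shift hA 1 n τ
    rw [pow_succ, ih, ← h, Int.cast_one, one_mul]
    refine (fundamental_comp hA.1 _ _ _).trans ?_
    congr 1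
    push_cast
    ring

/-- The reversed system at phase `-τ` runs through one period backwards, so its monodromy map
inverts the original one and `|μ|` becomes `1 / |μ|`. -/
theorem monodromy_timeRev_comp (hA : IsPeriodicLinfty T A) (τ : ℝ) :
    fundamental (timeRev A) (T + -τ) (-τ) ∘L fundamental A (T + τ) τ = .id ℝ _ ∧
      fundamental A (T + τ) τ ∘L fundamental (timeRev A) (T + -τ) (-τ) = .id ℝ _ := by
  have h := fundamental_add_int_mul hA 1 (-(T + -τ)) (- -τ)
  have e : fundamental (timeRev A) (T + -τ) (-τ) = fundamental A τ (T + τ) := by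
    rw [fundamental_timeRev hA.1, ← h]
    congr 1 <;> push_cast <;> ring
  rw [e, fundamental_comp hA.1, fundamental_comp hA.1, fundamental_self hA.1, fundamental_self hA.1]
  exact ⟨rfl, rfl⟩

theorem spectralSubspace_timeRev (hA : IsPeriodicLinfty T A) (τ : ℝ) {s t : Set ℂ}
    (hst : ∀ μ : ℂ, μ ≠ 0 → (μ ∈ s ↔ μ⁻¹ ∈ t)) :
    spectralSubspace (fundamental A (T + τ) τ) s =
      spectralSubspace (fundamental (timeRev A) (T + -τ) (-τ)) t := by
  obtain ⟨h1, h2⟩ := monodromy_timeRev_comp hA τ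
  refine le_antisymm (spectralSubspace_le_inv h1 h2 fun μ hμ h0 => (hst μ h0).1 hμ)
    (spectralSubspace_le_inv h2 h1 fun μ hμ h0 => (hst μ⁻¹ (inv_ne_zero h0)).2 ?_)
  rwa [inv_inv]

theorem unstable_eq_stable_timeRev (hT : 0 < T) (hA : IsPeriodicLinfty T A) (τ : ℝ) :
    unstable T A τ = stable T (timeRev A) (-τ) := by
  rw [unstable_eq hT hA.1, stable_eq hT (memLp_timeRev hA.1)]
  refine spectralSubspace_timeRev hA τ fun μ h0 => ?_
  rw [mem_ofPred_eq, mem_ofPred_eq, norm_inv, inv_lt_one₀ (norm_pos_iff.2 h0)]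

theorem centerStable_eq_centerUnstable_timeRev (hT : 0 < T) (hA : IsPeriodicLinfty T A) (τ : ℝ) :
    centerStable T A τ = centerUnstable T (timeRev A) (-τ) := by
  rw [centerStable_eq hT hA.1, centerUnstable_eq hT (memLp_timeRev hA.1)]
  refine spectralSubspace_timeRev hA τ fun μ h0 => ?_
  rw [mem_ofPred_eq, mem_ofPred_eq, norm_inv, one_le_inv₀ (norm_pos_iff.2 h0)]

end Floquet

/-! ### The autonomized system and its fibers. -/

section Autonomized

variable {d m : ℕ} {A : ℝ → E d →L[ℝ] E d} {B : ℝ → E m →L[ℝ] E d} {U : Set (E m)} {T : ℝ}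

theorem coe_phase [Fact (0 < T)] (σ : AddCircle T) : ((phase T σ : ℝ) : AddCircle T) = σ :=
  AddCircle.coe_equivIco

theorem phase_zero [Fact (0 < T)] : phase T 0 = 0 := by
  have h0 : (0 : ℝ) ∈ Ico 0 (0 + T) := ⟨le_rfl, by simpa using (Fact.out : 0 < T)⟩
  exact AddCircle.equivIco_coe_of_mem h0

theorem coe_eq_coe_iff_exists {x y : ℝ} :
    (x : AddCircle T) = y ↔ ∃ n : ℤ, x = n * T + y := by
  rw [← sub_eq_zero, ← AddCircle.coe_sub, AddCircle.coe_eq_zero_iff]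
  refine exists_congr fun n => ?_
  rw [zsmul_eq_mul]
  constructor <;> intro h <;> linarith

theorem coe_mem_autReach_iff [Fact (0 < T)] (hA : IsPeriodicLinfty T A)
    (hB : IsPeriodicLinfty T B) (h0 : (0 : E m) ∈ U) {τ : ℝ} {x : E d} :
    ((τ : AddCircle T), x) ∈ autReach T A B U (0, 0) ↔ x ∈ reachPeriods T A B U τ := by
  rw [mem_reachPeriods_iff Fact.out hA hB h0]
  constructor
  · rintro ⟨t, ht, u, hu, η, ⟨ξ, hξ, hξ0, hη⟩, hηt⟩
    rw [hη] at hηt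
    simp only [phase_zero, zero_add, Prod.mk.injEq] at hηt hξ0
    obtain ⟨n, rfl⟩ := coe_eq_coe_iff_exists.1 hηt.1
    exact ⟨n, ht, u, hu, ξ, hξ, hξ0, hηt.2⟩
  · rintro ⟨n, ht, u, hu, ξ, hξ, hξ0, hξt⟩
    refine ⟨n * T + τ, ht, u, hu, _, ⟨ξ, hξ, ?_, fun _ => rfl⟩, ?_⟩
    · simpa only [phase_zero] using hξ0
    · simp only [phase_zero, zero_add, hξt, Prod.mk.injEq, and_true]
      exact coe_eq_coe_iff_exists.2 ⟨n, rfl⟩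

/-! ### Controllable sets as reachable sets of the reversed system. -/

theorem mem_reachAt_timeRev {s t : ℝ} {x y : E d} (h : x ∈ reachAt A B U t s y) :
    y ∈ reachAt (timeRev A) (timeRev B) U (-s) (-t) x := by
  obtain ⟨hst, u, hu, ξ, hξ, hs, ht⟩ := h
  exact ⟨neg_le_neg hst, _, ⟨memLp_comp_neg hu.1, ae_comp_neg hu.2⟩, _, hξ.timeRev, by simpa,
    by simpa⟩

theorem mem_reachAt_timeRev_iff {s t : ℝ} {x y : E d} :
    y ∈ reachAt (timeRev A) (timeRev B) U (-s) (-t) x ↔ x ∈ reachAt A B U t s y := by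
  refine ⟨fun h => ?_, mem_reachAt_timeRev⟩
  simpa using mem_reachAt_timeRev h

theorem mem_ctrlAt_iff {s t : ℝ} {x y : E d} :
    y ∈ ctrlAt A B U t s x ↔ x ∈ reachAt A B U s t y := Iff.rfl

theorem ctrlPeriods_eq (τ : ℝ) :
    ctrlPeriods T A B U τ = reachPeriods T (timeRev A) (timeRev B) U (-τ) := by
  refine iUnion_congr fun k => ?_
  ext y
  rw [mem_ctrlAt_iff, ← mem_reachAt_timeRev_iff, neg_zero]
  congr! 2
  ring

theorem coe_mem_autCtrl_iff [Fact (0 < T)] (hA : IsPeriodicLinfty T A)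
    (hB : IsPeriodicLinfty T B) (h0 : (0 : E m) ∈ U) {σ : AddCircle T} {x : E d} :
    (σ, x) ∈ autCtrl T A B U (0, 0) ↔
      x ∈ reachPeriods T (timeRev A) (timeRev B) U (-phase T σ) := by
  rw [mem_reachPeriods_iff Fact.out hA.timeRev hB.timeRev h0]
  constructor
  · rintro ⟨t, ht, u, hu, η, ⟨ξ, hξ, hξ0, hη⟩, hηt⟩
    rw [hη, Prod.mk.injEq] at hηt
    obtain ⟨n, hn⟩ := (coe_eq_coe_iff_exists (y := 0)).1 hηt.1
    have h1 : (0 : E d) ∈ reachAt A B U (phase T σ + t) (phase T σ) x :=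
      ⟨le_add_of_nonneg_right ht, u, hu, ξ, hξ, hξ0, hηt.2⟩
    have h2 := reachAt_shift hA.timeRev hB.timeRev n (mem_reachAt_timeRev h1)
    refine ⟨n, ?_⟩
    convert h2 using 2
    · ring
    · rw [hn]
      ring
  · rintro ⟨n, hn⟩
    have h1 := reachAt_shift hA.timeRev.timeRev hB.timeRev.timeRev n (mem_reachAt_timeRev hn)
    simp only [timeRev_timeRev] at h1
    have e : -(n * T + -phase T σ) + n * T = phase T σ := by ring
    rw [neg_zero, zero_add, e] at h1
    obtain ⟨ht, u, hu, ξ, hξ, hξ0, hξt⟩ := h1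
    refine ⟨n * T - phase T σ, sub_nonneg.2 ht, u, hu, _, ⟨ξ, hξ, hξ0, fun _ => rfl⟩, ?_⟩
    rw [add_sub_cancel, hξt]
    refine Prod.ext ?_ rfl
    exact (coe_eq_coe_iff_exists (y := 0)).2 ⟨n, by simp⟩

theorem coe_mem_interior_autCtrl_iff [Fact (0 < T)] (hA : IsPeriodicLinfty T A)
    (hB : IsPeriodicLinfty T B) (h0 : (0 : E m) ∈ U) {σ : AddCircle T} {x : E d} :
    (σ, x) ∈ interior (autCtrl T A B U (0, 0)) ↔
      (((-phase T σ : ℝ) : AddCircle T), x) ∈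
        interior (autReach T (timeRev A) (timeRev B) U (0, 0)) := by
  -- Reflecting the circle is a homeomorphism, so it also matches the interiors.
  let Θ : AddCircle T × E d ≃ₜ AddCircle T × E d :=
    (Homeomorph.neg (AddCircle T)).prodCongr (Homeomorph.refl (E d))
  have hΘ : ∀ (σ : AddCircle T) (x : E d), Θ (σ, x) = (((-phase T σ : ℝ) : AddCircle T), x) := by
    intro σ x
    rw [AddCircle.coe_neg, coe_phase]
    rfl
  have hpre : autCtrl T A B U (0, 0) =
      Θ ⁻¹' autReach T (timeRev A) (timeRev B) U (0, 0) := by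
    ext ⟨σ, x⟩
    rw [mem_preimage, hΘ, coe_mem_autCtrl_iff hA hB h0,
      coe_mem_autReach_iff hA.timeRev hB.timeRev h0]
  rw [hpre, ← Θ.preimage_interior, mem_preimage, hΘ]

theorem mem_interior_reachPeriods_of_autReach [Fact (0 < T)] (hA : IsPeriodicLinfty T A)
    (hB : IsPeriodicLinfty T B) (h0 : (0 : E m) ∈ U) {τ : ℝ} {x : E d}
    (hx : ((τ : AddCircle T), x) ∈ interior (autReach T A B U (0, 0))) :
    x ∈ interior (reachPeriods T A B U τ) := by
  have hc : Continuous fun z : E d => ((τ : AddCircle T), z) := by fun_prop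
  rw [mem_interior_iff_mem_nhds] at hx ⊢
  filter_upwards [hc.continuousAt.preimage_mem_nhds hx] with z hz
  exact (coe_mem_autReach_iff hA hB h0).1 hz

/-- Running the system without control for at least one period yields interior points of the
reachable set of the autonomized system. -/
theorem coe_mem_interior_autReach [Fact (0 < T)] (hA : IsPeriodicLinfty T A)
    (hB : IsPeriodicLinfty T B) (h0 : (0 : E m) ∈ U) {τ : ℝ} {x : E d} {n : ℕ} (hn : 1 ≤ n)
    (hx : x ∈ interior (reachPeriods T A B U τ)) :
    ((τ : AddCircle T), fundamental A (n * T + τ) τ x) ∈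
      interior (autReach T A B U (0, 0)) := by
  have hT : 0 < T := Fact.out
  have hopen : IsOpenMap (Prod.map (fun r : ℝ => (r : AddCircle T)) (id : E d → E d)) :=
    IsOpenMap.prodMap QuotientAddGroup.isOpenMap_coe IsOpenMap.id
  -- For `(r, z)` near the target, flow back from time `nT + r` to `τ`. By continuity this lands in
  -- the interior of the fiber at `τ`; since `n ≥ 1`, `r > τ - T` gives `τ ≤ nT + r`, so the free
  -- flow forward returns to `z` along an admissible trajectory.
  have hQ : {p : ℝ × E d | p.2 ∈ reachPeriods T A B U p.1} ∈
      𝓝 (τ, fundamental A (n * T + τ) τ x) := by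
    have hc : Continuous fun p : ℝ × E d => fundamental A τ (n * T + p.1) p.2 :=
      ((continuous_fundamental_right hA.1 τ).comp
        (continuous_const.add continuous_fst)).clm_apply continuous_snd
    have h1 : ∀ᶠ p : ℝ × E d in 𝓝 (τ, fundamental A (n * T + τ) τ x),
        fundamental A τ (n * T + p.1) p.2 ∈ interior (reachPeriods T A B U τ) := by
      refine hc.continuousAt.eventually_mem (isOpen_interior.mem_nhds ?_)
      rw [fundamental_apply_fundamental hA.1, fundamental_self hA.1]
      exact hx
    have h2 : ∀ᶠ p : ℝ × E d in 𝓝 (τ, fundamental A (n * T + τ) τ x), τ - T < p.1 :=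
      continuous_fst.continuousAt.eventually_mem (Ioi_mem_nhds (by simpa using hT))
    filter_upwards [h1, h2] with p hp1 hp2
    have hle : τ ≤ n * T + p.1 := by
      have : (1 : ℝ) * T ≤ n * T := by
        gcongr
        exact_mod_cast hn
      linarith
    have := fundamental_mem_reachPeriods hA hB h0 hle (interior_subset hp1)
    rw [fundamental_apply_fundamental hA.1, fundamental_self hA.1, add_comm,
      ← Int.cast_natCast, reachPeriods_add_int_mul hT hA hB h0] at this
    exact this
  rw [mem_interior_iff_mem_nhds]
  refine Filter.mem_of_superset (hopen.image_mem_nhds hQ) ?_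
  rintro _ ⟨⟨r, z⟩, hrz, rfl⟩
  exact (coe_mem_autReach_iff hA hB h0).2 hrz

/-! ### Convexity and uniform boundedness of the stable part. -/

theorem fundamental_image_KMinus_subset (hT : 0 < T) (hA : IsPeriodicLinfty T A) (n : ℤ) (τ : ℝ) :
    fundamental A (n * T + τ) τ '' KMinus T A B U τ ⊆ stable T A τ := by
  rintro _ ⟨k, hk, rfl⟩
  have := fundamental_mem_stable hT hA τ (τ + n * T) hk.2
  rw [stable_add_int_mul hA] at this
  rwa [add_comm _ τ]

theorem convex_KMinus (hT : 0 < T) (hA : IsPeriodicLinfty T A) (hB : IsPeriodicLinfty T B)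
    (h0 : (0 : E m) ∈ U) (hU : Convex ℝ U) (τ : ℝ) : Convex ℝ (KMinus T A B U τ) :=
  (convex_reachPeriods hT hA hB h0 hU τ).interior.inter (stable T A τ).convex

theorem exists_eq_sum_pow (hA : IsPeriodicLinfty T A) (hB : IsPeriodicLinfty T B) (hT : 0 < T)
    {ρ : ℝ} (hρ : ∀ y ∈ reachAt A B U (T + 0) 0 0, ‖y‖ ≤ ρ) (hρ0 : 0 ≤ ρ) (n : ℕ) {x : E d}
    (hx : x ∈ reachAt A B U (n * T + 0) 0 0) :
    ∃ r : ℕ → E d, (∀ j, ‖r j‖ ≤ ρ) ∧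
      x = ∑ j ∈ Finset.range n, (fundamental A (T + 0) 0 ^ j) (r j) := by
  induction n generalizing x with
  | zero =>
    refine ⟨fun _ => 0, fun _ => by simpa, ?_⟩
    obtain ⟨-, u, hu, ξ, hξ, hξ0, hξt⟩ := hx
    rw [← hξt]
    simp [hξ0]
  | succ n ih =>
    obtain ⟨a, ha, b, hb, rfl⟩ := reachAt_split hA.1 hB.1 hx (s := n * T + 0) (by positivity)
      (by push_cast; linarith)
    obtain ⟨r, hr, rfl⟩ := ih ha
    have hb' := reachAt_shift hA hB (-n) hb
    have e1 : ((n + 1 : ℕ) : ℝ) * T + 0 + ((-n : ℤ) : ℝ) * T = T + 0 := by push_cast; ring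
    have e2 : (n : ℝ) * T + 0 + ((-n : ℤ) : ℝ) * T = 0 := by push_cast; ring
    rw [e1, e2] at hb'
    -- The contribution of the last period carries the power 0; the earlier ones gain one factor of
    -- the monodromy map.
    refine ⟨fun j => Nat.casesOn j b r, fun j => ?_, ?_⟩
    · cases j with
      | zero => exact hρ b hb'
      | succ j => exact hr j
    · have e3 : fundamental A (((n + 1 : ℕ) : ℝ) * T + 0) (n * T + 0) =
          fundamental A (T + 0) 0 := by
        have := fundamental_period_shift hA n 1 0
        rw [Nat.cast_one, one_mul, Int.cast_natCast] at this
        rw [← this]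
        congr 1
        push_cast
        ring
      rw [e3, map_sum, Finset.sum_range_succ']
      simp only [pow_succ']
      rfl

/-- The spectral projection to the stable space commutes with the monodromy map, so it turns the sum
over periods into a uniformly bounded one at phase 0. Other phases follow by free flow over a
compact range of times. Negative `τ` are included because time reversal leads to the phase `-τ`. -/
theorem exists_bound_KMinus (hT : 0 < T) (hA : IsPeriodicLinfty T A) (hB : IsPeriodicLinfty T B)
    (h0 : (0 : E m) ∈ U) (hU : Bornology.IsBounded U) :
    ∃ r : ℝ, ∀ τ ∈ Icc (-T) T, ∀ x ∈ KMinus T A B U τ, ‖x‖ ≤ r := by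
  set M := fundamental A (T + 0) 0 with hM
  obtain ⟨ρ, hρ⟩ := exists_bound_reachAt hA.1 hB.1 hU (T + 0) 0
  have hρ0 : 0 ≤ ρ := by
    simpa using hρ 0 (zero_mem_reachAt h0 (by linarith))
  have hcompl := isCompl_stable_centerUnstable hT hA.1 0
  set p : E d →L[ℝ] E d :=
    LinearMap.toContinuousLinearMap ((stable T A 0).projection _ hcompl) with hp
  have hpM : ∀ x, p (M x) = M (p x) := by
    intro x
    have hperiod : T + 0 = 0 + (1 : ℤ) * T := by push_cast; ring
    have h1 : M (p x) ∈ stable T A 0 := by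
      have := fundamental_mem_stable hT hA 0 (T + 0)
        (Submodule.projection_apply_mem hcompl x)
      rw [hperiod, stable_add_int_mul hA, ← hperiod] at this
      exact this
    have h2 : M (x - p x) ∈ centerUnstable T A 0 := by
      have hx : x - p x ∈ centerUnstable T A 0 := by
        rw [← Submodule.projection_apply_eq_zero_iff hcompl, map_sub, sub_eq_zero]
        exact (Submodule.projection_apply_left hcompl
          ⟨_, Submodule.projection_apply_mem hcompl x⟩).symm
      have := fundamental_mem_centerUnstable hT hA 0 (T + 0) hx
      rw [hperiod, centerUnstable_add_int_mul hA, ← hperiod] at this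
      exact this
    have e : M x = M (p x) + M (x - p x) := by rw [← map_add]; simp
    have h3 : p (M (x - p x)) = 0 := (Submodule.projection_apply_eq_zero_iff hcompl).2 h2
    have h4 : p (M (p x)) = M (p x) := Submodule.projection_apply_left hcompl ⟨_, h1⟩
    rw [e, map_add, h3, h4, add_zero]
  have hpMj : ∀ (j : ℕ) x, p ((M ^ j) x) = (M ^ j) (p x) := by
    intro j
    induction j with
    | zero => intro x; rfl
    | succ j ih =>
      intro x
      rw [pow_succ, mul_apply_eq_comp, mul_apply_eq_comp, ih, hpM]
  obtain ⟨C, hC, hCb⟩ := exists_bound_sum_pow M p fun x => by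
    rw [← stable_eq hT hA.1]
    exact Submodule.projection_apply_mem hcompl x
  -- `2T` is a time of phase 0 that lies after every `τ ∈ [-T, T]`; `K` bounds the flow back from
  -- it.
  obtain ⟨K, hK⟩ := (isCompact_Icc (a := -T) (b := T)).exists_bound_of_continuousOn
    (continuous_fundamental hA.1 (0 + (2 : ℤ) * T)).continuousOn
  refine ⟨K * (C * ρ), fun τ hτ x hx => ?_⟩
  have hle : τ ≤ 0 + (2 : ℤ) * T := by
    push_cast
    linarith [hτ.2]
  have hys := fundamental_mem_stable hT hA τ (0 + (2 : ℤ) * T) hx.2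
  have hyr := fundamental_mem_reachPeriods hA hB h0 hle (interior_subset hx.1)
  rw [stable_add_int_mul hA] at hys
  rw [reachPeriods_add_int_mul hT hA hB h0, reachPeriods, mem_iUnion] at hyr
  obtain ⟨n, hn⟩ := hyr
  obtain ⟨r, hr, hyr⟩ := exists_eq_sum_pow hA hB hT hρ hρ0 n hn
  have hy : ‖fundamental A (0 + (2 : ℤ) * T) τ x‖ ≤ C * ρ := by
    have h1 : p (fundamental A (0 + (2 : ℤ) * T) τ x) = fundamental A (0 + (2 : ℤ) * T) τ x :=
      Submodule.projection_apply_left hcompl ⟨_, hys⟩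
    rw [← h1, hyr, map_sum]
    simp only [← hM, hpMj]
    exact hCb n r ρ hr
  have hxx : x = fundamental A τ (0 + (2 : ℤ) * T) (fundamental A (0 + (2 : ℤ) * T) τ x) := by
    rw [fundamental_apply_fundamental hA.1, fundamental_self hA.1]
    rfl
  rw [hxx]
  exact ContinuousLinearMap.le_of_opNorm_le_of_le _ (hK τ hτ) hy

/-- Everything is reachable from the origin in finitely many periods, for every initial phase. -/
def PeriodReachable (T : ℝ) (A : ℝ → E d →L[ℝ] E d) (B : ℝ → E m →L[ℝ] E d) : Prop :=
  ∀ τ : ℝ, ∃ n : ℕ, ∀ x : E d, x ∈ reachAt A B univ (n * T + τ) τ 0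

theorem Controllable.periodReachable (hT : 0 < T) (hA : IsPeriodicLinfty T A)
    (hB : IsPeriodicLinfty T B) (h : Controllable A B) : PeriodReachable T A B :=
  fun τ => exists_forall_mem_reachAt hT hA hB τ fun x => h x 0 τ

/-- A trajectory from 0 to `x`, run backwards, steers `x` to 0, and null-controllability of the
reversed system suffices for `exists_forall_mem_reachAt`. -/
theorem PeriodReachable.timeRev (hT : 0 < T) (hA : IsPeriodicLinfty T A)
    (hB : IsPeriodicLinfty T B) (h : PeriodReachable T A B) :
    PeriodReachable T (timeRev A) (timeRev B) := by
  refine fun τ => exists_forall_mem_reachAt hT hA.timeRev hB.timeRev τ fun x => ?_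
  obtain ⟨n, hn⟩ := h (-τ)
  have h1 := reachAt_shift hA hB (-n) (hn x)
  -- The extra period makes the elapsed time positive even for `n = 0`.
  have h2 : -τ - (n + 1) * T ≤ -τ + ((-n : ℤ) : ℝ) * T := by
    push_cast
    linarith
  have h3 := mem_reachAt_timeRev (reachAt_anti_start hA.1 hB.1 (mem_univ _) h2 h1)
  have e : -(n * T + -τ + ((-n : ℤ) : ℝ) * T) = τ := by
    push_cast
    ring
  rw [e] at h3
  refine ⟨_, ?_, h3⟩
  have : 0 ≤ (n : ℝ) * T := by positivity
  linarith

theorem PeriodReachable.zero_mem_interior (hT : 0 < T) (hA : IsPeriodicLinfty T A)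
    (hB : IsPeriodicLinfty T B) (hU : U ∈ 𝓝 (0 : E m)) (hreach : PeriodReachable T A B) (τ : ℝ) :
    (0 : E d) ∈ interior (reachPeriods T A B U τ) := by
  obtain ⟨n, hn⟩ := hreach τ
  exact zero_mem_interior_reachPeriods hT hA hB hU hn

theorem PeriodReachable.centerUnstable_subset (hT : 0 < T) (hA : IsPeriodicLinfty T A)
    (hB : IsPeriodicLinfty T B) (hU : U ∈ 𝓝 (0 : E m)) (hUc : Convex ℝ U)
    (hreach : PeriodReachable T A B) (τ : ℝ) :
    (centerUnstable T A τ : Set (E d)) ⊆ interior (reachPeriods T A B U τ) := by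
  obtain ⟨n, hn⟩ := hreach τ
  have h0 := mem_of_mem_nhds hU
  rw [centerUnstable_eq hT hA.1]
  refine spectralSubspace_subset_interior _ n (convex_reachPeriods hT hA hB h0 hUc τ)
    (zero_mem_reachPeriods hT h0 τ) (reachAt_mem_nhds hA.1 hB.1 hU hn) fun a ha v hv => ?_
  rw [monodromy_pow hA]
  exact fundamental_add_mem_reachPeriods hA hB ha hv

theorem PeriodReachable.add_mem_interior (hT : 0 < T) (hA : IsPeriodicLinfty T A)
    (hB : IsPeriodicLinfty T B) (hU : U ∈ 𝓝 (0 : E m)) (hUc : Convex ℝ U)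
    (hreach : PeriodReachable T A B) {τ : ℝ} {x f : E d}
    (hx : x ∈ interior (reachPeriods T A B U τ)) (hf : f ∈ centerUnstable T A τ) :
    x + f ∈ interior (reachPeriods T A B U τ) :=
  add_mem_interior_of_submodule (convex_reachPeriods hT hA hB (mem_of_mem_nhds hU) hUc τ)
    ((hreach.centerUnstable_subset hT hA hB hU hUc τ).trans interior_subset) hx hf

theorem PeriodReachable.coe_zero_mem [Fact (0 < T)] (hA : IsPeriodicLinfty T A)
    (hB : IsPeriodicLinfty T B) (hU : U ∈ 𝓝 (0 : E m)) (hreach : PeriodReachable T A B) (τ : ℝ) :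
    ((τ : AddCircle T), (0 : E d)) ∈ interior (autReach T A B U (0, 0)) := by
  simpa using coe_mem_interior_autReach hA hB (mem_of_mem_nhds hU) le_rfl
    (hreach.zero_mem_interior Fact.out hA hB hU τ)

theorem PeriodReachable.coe_add_mem [Fact (0 < T)] (hA : IsPeriodicLinfty T A)
    (hB : IsPeriodicLinfty T B) (hU : U ∈ 𝓝 (0 : E m)) (hUc : Convex ℝ U)
    (hreach : PeriodReachable T A B) {τ : ℝ} {k f : E d} (hk : k ∈ KMinus T A B U τ)
    (hf : f ∈ centerUnstable T A τ) :
    ((τ : AddCircle T), fundamental A (d * T + τ) τ k + f) ∈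
      interior (autReach T A B U (0, 0)) := by
  have hT : 0 < T := Fact.out
  -- For `d = 0` the state space is a point. Otherwise only `d ≥ 1` matters: any positive number of
  -- periods would do.
  rcases Nat.eq_zero_or_pos d with rfl | hd
  · rw [Subsingleton.elim (fundamental A _ τ k + f) 0]
    exact hreach.coe_zero_mem hA hB hU τ
  · have hf' : fundamental A τ (d * T + τ) f ∈ centerUnstable T A τ := by
      refine fundamental_mem_centerUnstable hT hA _ _ ?_
      rw [add_comm, ← Int.cast_natCast, centerUnstable_add_int_mul hA]
      exact hf
    have := coe_mem_interior_autReach hA hB (mem_of_mem_nhds hU) hd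
      (hreach.add_mem_interior hT hA hB hU hUc hk.1 hf')
    rwa [map_add, fundamental_apply_fundamental hA.1, fundamental_self hA.1] at this

/-- Subtracting the center-unstable component of `x` stays in the interior of the fiber and leaves a
stable vector, hence an element of `K⁻`. -/
theorem PeriodReachable.exists_add_eq [Fact (0 < T)] (hA : IsPeriodicLinfty T A)
    (hB : IsPeriodicLinfty T B) (hU : U ∈ 𝓝 (0 : E m)) (hUc : Convex ℝ U)
    (hreach : PeriodReachable T A B) {τ : ℝ} {x : E d}
    (hx : ((τ : AddCircle T), x) ∈ interior (autReach T A B U (0, 0))) :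
    ∃ k ∈ KMinus T A B U τ, ∃ f ∈ centerUnstable T A τ, x = k + f := by
  have hT : 0 < T := Fact.out
  have hx' := mem_interior_reachPeriods_of_autReach hA hB (mem_of_mem_nhds hU) hx
  obtain ⟨k, hk, f, hf, hkf⟩ := Submodule.mem_sup.1
    ((isCompl_stable_centerUnstable hT hA.1 τ).sup_eq_top ▸ Submodule.mem_top (x := x))
  refine ⟨k, ⟨?_, hk⟩, f, hf, hkf.symm⟩
  have := hreach.add_mem_interior hT hA hB hU hUc hx' (neg_mem hf)
  rwa [← hkf, add_neg_cancel_right] at this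

theorem KPlus_eq (hT : 0 < T) (hA : IsPeriodicLinfty T A) (τ : ℝ) :
    KPlus T A B U τ = KMinus T (timeRev A) (timeRev B) U (-τ) := by
  rw [KPlus, KMinus, ctrlPeriods_eq, unstable_eq_stable_timeRev hT hA]

theorem fundamental_neg_period (hA : MemLp A ⊤ volume) (n : ℕ) (τ : ℝ) :
    fundamental A (-(n * T) + τ) τ = fundamental (timeRev A) (n * T + -τ) (-τ) := by
  rw [fundamental_timeRev hA]
  congr 1 <;> ring

end Autonomized

end PeriodicLinear

end

/-! ### Assembly: the reachable set directly, the controllable set by time reversal. -/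

theorem mainTheorem2 {d m : ℕ} (T : ℝ) [Fact (0 < T)]
    (A : ℝ → PeriodicLinear.E d →L[ℝ] PeriodicLinear.E d)
    (B : ℝ → PeriodicLinear.E m →L[ℝ] PeriodicLinear.E d)
    (hA : PeriodicLinear.IsPeriodicLinfty T A) (hB : PeriodicLinear.IsPeriodicLinfty T B)
    (U : Set (PeriodicLinear.E m)) (hUconvex : Convex ℝ U) (hUbounded : Bornology.IsBounded U)
    (hUnhds : U ∈ 𝓝 (0 : PeriodicLinear.E m))
    (hcontrollable : PeriodicLinear.Controllable A B) :
    -- reachable set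
    ((univ ×ˢ {0} ⊆ interior (PeriodicLinear.autReach T A B U (0, 0))) ∧
      (PeriodicLinear.fiberSum
          (PeriodicLinear.bundle T fun τ =>
            PeriodicLinear.fundamental A (d * T + τ) τ '' PeriodicLinear.KMinus T A B U τ)
          (PeriodicLinear.bundle T fun τ => (PeriodicLinear.centerUnstable T A τ : Set _))
        ⊆ interior (PeriodicLinear.autReach T A B U (0, 0))) ∧
      (interior (PeriodicLinear.autReach T A B U (0, 0)) ⊆
        PeriodicLinear.fiberSum
          (PeriodicLinear.bundle T fun τ => PeriodicLinear.KMinus T A B U τ)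
          (PeriodicLinear.bundle T fun τ => (PeriodicLinear.centerUnstable T A τ : Set _))) ∧
      (∀ τ ∈ Ico 0 T, Convex ℝ (PeriodicLinear.KMinus T A B U τ)) ∧
      (∃ r : ℝ, ∀ τ ∈ Ico 0 T, ∀ x ∈ PeriodicLinear.KMinus T A B U τ, ‖x‖ ≤ r) ∧
      -- the fiberwise sums above are direct
      (∀ τ ∈ Ico 0 T,
        IsCompl (PeriodicLinear.stable T A τ) (PeriodicLinear.centerUnstable T A τ) ∧
        PeriodicLinear.fundamental A (d * T + τ) τ '' PeriodicLinear.KMinus T A B U τ ⊆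
          PeriodicLinear.stable T A τ)) ∧
    -- controllable set
    ((univ ×ˢ {0} ⊆ interior (PeriodicLinear.autCtrl T A B U (0, 0))) ∧
      (PeriodicLinear.fiberSum
          (PeriodicLinear.bundle T fun τ => (PeriodicLinear.centerStable T A τ : Set _))
          (PeriodicLinear.bundle T fun τ =>
            PeriodicLinear.fundamental A (-(d * T) + τ) τ '' PeriodicLinear.KPlus T A B U τ)
        ⊆ interior (PeriodicLinear.autCtrl T A B U (0, 0))) ∧
      (interior (PeriodicLinear.autCtrl T A B U (0, 0)) ⊆
        PeriodicLinear.fiberSum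
          (PeriodicLinear.bundle T fun τ => (PeriodicLinear.centerStable T A τ : Set _))
          (PeriodicLinear.bundle T fun τ => PeriodicLinear.KPlus T A B U τ)) ∧
      (∀ τ ∈ Ico 0 T, Convex ℝ (PeriodicLinear.KPlus T A B U τ)) ∧
      (∃ r : ℝ, ∀ τ ∈ Ico 0 T, ∀ x ∈ PeriodicLinear.KPlus T A B U τ, ‖x‖ ≤ r) ∧
      (∀ τ ∈ Ico 0 T,
        IsCompl (PeriodicLinear.centerStable T A τ) (PeriodicLinear.unstable T A τ) ∧
        PeriodicLinear.fundamental A (-(d * T) + τ) τ '' PeriodicLinear.KPlus T A B U τ ⊆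
          PeriodicLinear.unstable T A τ)) := by
  open PeriodicLinear in
  have hT : 0 < T := Fact.out
  have h0 := mem_of_mem_nhds hUnhds
  have hreach := hcontrollable.periodReachable hT hA hB
  have hrev := hreach.timeRev hT hA hB
  have hA' := hA.timeRev
  have hB' := hB.timeRev
  refine ⟨⟨?_, ?_, ?_, fun τ _ => convex_KMinus hT hA hB h0 hUconvex τ, ?_, fun τ _ =>
    ⟨isCompl_stable_centerUnstable hT hA.1 τ, ?_⟩⟩, ⟨?_, ?_, ?_, fun τ _ => ?_, ?_, fun τ _ =>
    ⟨?_, ?_⟩⟩⟩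
  · rintro ⟨σ, x⟩ ⟨-, rfl⟩
    rw [← coe_phase σ]
    exact hreach.coe_zero_mem hA hB hUnhds _
  · rintro ⟨σ, x⟩ ⟨v, w, ⟨k, hk, hkv⟩, hw, hx⟩
    have := hreach.coe_add_mem hA hB hUnhds hUconvex hk hw
    rw [coe_phase] at this
    convert this using 2
    rw [hkv]
    exact hx
  · rintro ⟨σ, x⟩ hx
    rw [← coe_phase σ] at hx
    obtain ⟨k, hk, f, hf, rfl⟩ := hreach.exists_add_eq hA hB hUnhds hUconvex hx
    exact ⟨k, f, hk, hf, rfl⟩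
  · obtain ⟨r, hr⟩ := exists_bound_KMinus hT hA hB h0 hUbounded
    exact ⟨r, fun τ hτ => hr τ ⟨by linarith [hτ.1], hτ.2.le⟩⟩
  · exact_mod_cast fundamental_image_KMinus_subset hT hA d τ
  · rintro ⟨σ, x⟩ ⟨-, rfl⟩
    rw [coe_mem_interior_autCtrl_iff hA hB h0]
    exact hrev.coe_zero_mem hA' hB' hUnhds _
  · rintro ⟨σ, x⟩ ⟨v, w, hv, ⟨k, hk, hkw⟩, hx⟩
    rw [coe_mem_interior_autCtrl_iff hA hB h0]
    simp only [KPlus_eq hT hA] at hk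
    have hv' : v ∈ centerStable T A (phase T σ) := hv
    rw [centerStable_eq_centerUnstable_timeRev hT hA] at hv'
    have := hrev.coe_add_mem hA' hB' hUnhds hUconvex hk hv'
    rw [← fundamental_neg_period hA.1] at this
    convert this using 2
    rw [hkw, add_comm]
    exact hx
  · rintro ⟨σ, x⟩ hx
    rw [coe_mem_interior_autCtrl_iff hA hB h0] at hx
    obtain ⟨k, hk, f, hf, rfl⟩ := hrev.exists_add_eq hA' hB' hUnhds hUconvex hx
    rw [← KPlus_eq hT hA] at hk
    rw [← centerStable_eq_centerUnstable_timeRev hT hA] at hf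
    exact ⟨f, k, hf, hk, add_comm _ _⟩
  · rw [KPlus_eq hT hA]
    exact convex_KMinus hT hA' hB' h0 hUconvex _
  · obtain ⟨r, hr⟩ := exists_bound_KMinus hT hA' hB' h0 hUbounded
    refine ⟨r, fun τ hτ x hx => ?_⟩
    rw [KPlus_eq hT hA] at hx
    exact hr (-τ) ⟨neg_le_neg hτ.2.le, by linarith [hτ.1]⟩ x hx
  · rw [centerStable_eq_centerUnstable_timeRev hT hA, unstable_eq_stable_timeRev hT hA]
    exact (isCompl_stable_centerUnstable hT hA'.1 _).symm
  · rw [KPlus_eq hT hA, unstable_eq_stable_timeRev hT hA, fundamental_neg_period hA.1]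
    exact_mod_cast fundamental_image_KMinus_subset hT hA' d (-τ)
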